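/- Let $d\ge 3$. There are constants $k_d>0$ and $n_0$, depending only on $d$, such that the following holds for every $n\ge n_0$ with $nd$ even. Let $e=\lfloor n^{1/4}\rfloor$, let $s\in\{1,2\}$, and let $Q$ be the fixed query sequence $Q=(e,\,s,\,s+1,\,\dots,\,e-1)$ (for $s=1$ it has exactly $e$ queries; for $s=2$ it is $(e,2,3,\dots,e-1)$). Let $v_0\in[n]$ be a start vertex. Let $\mathbf G(n,d)$ be the uniform distribution on simple $d$-regular graphs with vertex set $[n]$; for such a graph $G$ let $P_Q(G)$ be the joint distribution of the positions, at the times in $Q$, of a random walk on $G$ that is at $v_0$ at time $0$. Then there is a family of functions $F_G:[n]^{|Q|}\to\{0,1\}$, one for each $d$-regular graph $G$ on $[n]$, such that every (possibly randomized) algorithm $\mathcal A$ of the following kind satisfies $$\mathbb E_{G\leftarrow \mathbf G(n,d)}\bigl|F_G(P_Q(G))-F_G(D_{G,\mathcal A,Q})\bigr|\ \ge\ 0.99 .$$ The algorithm $\mathcal A$ receives the queries of $Q$ one after the other, keeps an arbitrary internal state, and answers each query with a vertex before it receives the next. It has access to $G$ only through two kinds of probes: $\textsc{rand\_vertex}$,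 which returns a uniformly random vertex, and $\textsc{rand\_neighbor}(v)$, which returns a uniformly random neighbor of $v$. On every $d$-regular $G$ and in every possible run over $Q$ it makes fewer than $n^{1/4}/k_d$ probes for each query. Here $D_{G,\mathcal A,Q}$ is the joint distribution of the answers of $\mathcal A$ with probe access to $G$ on the query sequence $Q$, and $F_G(D)$ denotes the expected value of $F_G$ under $D$. -/

import Mathlib

/-- A uniformly random neighbour of `v` in `G` (the value at an isolated vertex, which a regular
graph of positive degree does not have, is irrelevant). -/
noncomputable def randNeighbor {V : Type} [Fintype V] (G : SimpleGraph V) (v : V) : PMF V :=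
  open Classical in
  if h : (G.neighborFinset v).Nonempty then PMF.uniformOfFinset (G.neighborFinset v) h
  else PMF.pure v

/-- The random walk on `G` of length `l` from `v`, as a random function of time: the position at
time `0` is `v`, and every later position is a uniform neighbour of the one before.
(After time `l` the function is constant.) -/
noncomputable def randomWalk {V : Type} [Fintype V] (G : SimpleGraph V) : ℕ → V → PMF (ℕ → V)
  | 0, v => PMF.pure fun _ => v
  | l + 1, v => (randNeighbor G v).bind fun w =>
      (randomWalk G l w).map fun path t => Nat.casesOn t v path

/-- The joint distribution of the positions, at the times listed in `Q`, of a random walk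
from `v`. -/
noncomputable def walkPositions {V : Type} [Fintype V] (G : SimpleGraph V) (v : V)
    (Q : List ℕ) : PMF (List V) :=
  (randomWalk G (Q.foldr max 0) v).map fun path => Q.map path

/-- A randomized computation with result in `α` that sees a graph on `V` only through probes.
It may draw internal randomness from any discrete distribution (`sample`), ask for a uniformly
random vertex (`askVertex`), or ask for a uniformly random neighbour of a vertex of its
choice (`askNeighbor`). -/
inductive ProbeProgram (V α : Type) : Type
  | ret (a : α) : ProbeProgram V α
  | sample (p : PMF ℕ) (next : ℕ → ProbeProgram V α) : ProbeProgram V α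
  | askVertex (next : V → ProbeProgram V α) : ProbeProgram V α
  | askNeighbor (v : V) (next : V → ProbeProgram V α) : ProbeProgram V α

/-- The joint distribution of the result and the number of probes made when the program is run
on `G`. Internal randomness is free; each vertex probe and each neighbour probe counts `1`. -/
noncomputable def ProbeProgram.run {V α : Type} [Fintype V] [Nonempty V] (G : SimpleGraph V) :
    ProbeProgram V α → PMF (α × ℕ)
  | .ret a => PMF.pure (a, 0)
  | .sample p next => p.bind fun i => (next i).run G
  | .askVertex next => (PMF.uniformOfFintype V).bind fun w =>
      ((next w).run G).map fun r => (r.1, r.2 + 1)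
  | .askNeighbor v next => (randNeighbor G v).bind fun w =>
      ((next w).run G).map fun r => (r.1, r.2 + 1)

/-- A randomized algorithm that answers position queries online: given its internal state and a
queried time it probes the graph and returns a vertex and its new internal state. -/
structure QueryAlgorithm (V : Type) where
  State : Type
  init : PMF State
  answer : State → ℕ → ProbeProgram V (V × State)

/-- The run on `G` from internal state `x` over the given queries, in the given order: the random
list of pairs (returned vertex, number of probes made for that query). -/
noncomputable def QueryAlgorithm.runFrom {V : Type} [Fintype V] [Nonempty V]
    (A : QueryAlgorithm V) (G : SimpleGraph V) : A.State → List ℕ → PMF (List (V × ℕ))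
  | _, [] => PMF.pure []
  | x, t :: Q => ((A.answer x t).run G).bind fun r =>
      (A.runFrom G r.1.2 Q).map fun rest => (r.1.1, r.2) :: rest

/-- The run of `A` on `G` over the query sequence `Q`. -/
noncomputable def QueryAlgorithm.transcript {V : Type} [Fintype V] [Nonempty V]
    (A : QueryAlgorithm V) (G : SimpleGraph V) (Q : List ℕ) : PMF (List (V × ℕ)) :=
  A.init.bind fun x => A.runFrom G x Q

/-- The joint distribution of the responses of `A` on `G` over `Q`, in the order of `Q`. -/
noncomputable def QueryAlgorithm.responses {V : Type} [Fintype V] [Nonempty V]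
    (A : QueryAlgorithm V) (G : SimpleGraph V) (Q : List ℕ) : PMF (List V) :=
  (A.transcript G Q).map fun out => out.map Prod.fst

/-- In every possible run on `G` over `Q`, every single query is answered with fewer than `b`
probes. -/
def QueryAlgorithm.FewerProbesThan {V : Type} [Fintype V] [Nonempty V]
    (A : QueryAlgorithm V) (G : SimpleGraph V) (Q : List ℕ) (b : ℝ) : Prop :=
  ∀ out ∈ (A.transcript G Q).support, ∀ r ∈ out, (r.2 : ℝ) < b

/-- The expected value of a `{0,1}`-valued function under a distribution. -/
noncomputable def acceptProb {α : Type} (f : α → Bool) (p : PMF α) : ℝ :=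
  ((p.map f) true).toReal

open Classical in
/-- The simple `d`-regular graphs on the vertex set `Fin n`. -/
noncomputable def regularGraphs (n d : ℕ) : Finset (SimpleGraph (Fin n)) :=
  Finset.univ.filter fun G => G.IsRegularOfDegree d

/-- The expectation of `X G` for `G` uniform among the `d`-regular graphs on `n` vertices. -/
noncomputable def expectRegular (n d : ℕ) (X : SimpleGraph (Fin n) → ℝ) : ℝ :=
  (∑ G ∈ regularGraphs n d, X G) / ((regularGraphs n d).card : ℝ)

/-- The times `(e, s, s + 1, …, e - 1)` where `e` is `n ^ (1 / 4)`, rounded down. -/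
noncomputable def queryTimes (n s : ℕ) : List ℕ :=
  ⌊(n : ℝ) ^ (1 / 4 : ℝ)⌋₊ :: List.Ico s ⌊(n : ℝ) ^ (1 / 4 : ℝ)⌋₊

/-! Write `m` for the maximal number of probes per query, about `n ^ (1/4) / (100 d)`. The test
`F_G` accepts if the answers are positions of a walk of length `e` in `G` from `v₀` whose reduced
form (all backtracking cancelled) has more than `m` steps.

The true walk passes. Since `d ≥ 3`, each step cancels with probability at most `1/3`, so the
reduced length drifts upwards; an exponential potential (`expect_reduceFrom_le`) makes a reduced
length of at most `m`, far below `e`, very unlikely.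

The algorithm fails. Every `d`-regular graph that contains the revealed edges produces a given
transcript with the same probability, so conditionally on the transcript `G` is uniform on
`regularAbove d H`, with `H` the graph of revealed edges. A switching argument
(`card_regularAbove_edge_le`) shows that any further edge is present with probability at most `q =
2d/n`. All queries together use `M = O(√n / d)` probes, so with high probability no new edge leads
back to a vertex already seen: each new edge hangs a pendant vertex on `H`. The answer `x` at time
`e` is fixed after at most `m` probes, when nonbacktracking walks in `H` from `v₀` have at most `m`
steps. Later pendant vertices create no new nonbacktracking walk between `v₀` and `x`, so at the end
these walks are still short. A walk with a long reduced form therefore needs an unrevealed edge, and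
this is unlikely for any fixed list of answers (`sum_isLongWalk_le`), even if the position at time 1
is not asked. -/

open scoped ENNReal

/-! ### Expectations under discrete distributions, with values in `ℝ≥0∞` -/

section Expectation

/-- The expectation of a nonnegative function under a discrete distribution. -/
noncomputable def PMF.expect {α : Type*} (p : PMF α) (f : α → ℝ≥0∞) : ℝ≥0∞ := ∑' a, p a * f a

namespace PMF

variable {α β ι : Type*}

theorem expect_pure (a : α) (f : α → ℝ≥0∞) : (PMF.pure a).expect f = f a := by
  classical
  rw [expect, tsum_eq_single a] <;> simp +contextual [PMF.pure_apply]

theorem expect_bind (p : PMF α) (q : α → PMF β) (f : β → ℝ≥0∞) :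
    (p.bind q).expect f = p.expect fun a => (q a).expect f := by
  simp only [expect, PMF.bind_apply, ← ENNReal.tsum_mul_right, ← ENNReal.tsum_mul_left]
  rw [ENNReal.tsum_comm]
  simp only [mul_assoc]

theorem expect_map (p : PMF α) (g : α → β) (f : β → ℝ≥0∞) :
    (p.map g).expect f = p.expect fun a => f (g a) := by
  rw [PMF.map, expect_bind]
  simp [expect_pure]

theorem expect_mono_support (p : PMF α) {f g : α → ℝ≥0∞} (h : ∀ a ∈ p.support, f a ≤ g a) :
    p.expect f ≤ p.expect g := by
  refine ENNReal.tsum_le_tsum fun a => ?_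
  by_cases ha : p a = 0
  · simp [ha]
  · gcongr
    exact h a ((p.mem_support_iff a).2 ha)

theorem expect_const (p : PMF α) (c : ℝ≥0∞) : (p.expect fun _ => c) = c := by
  rw [expect, ENNReal.tsum_mul_right, p.tsum_coe, one_mul]

theorem expect_le_of_support (p : PMF α) {f : α → ℝ≥0∞} {c : ℝ≥0∞}
    (h : ∀ a ∈ p.support, f a ≤ c) : p.expect f ≤ c :=
  (p.expect_mono_support h).trans_eq (p.expect_const c)

theorem expect_const_mul (p : PMF α) (c : ℝ≥0∞) (f : α → ℝ≥0∞) :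
    (p.expect fun a => c * f a) = c * p.expect f := by
  simp only [expect, ← ENNReal.tsum_mul_left]
  exact tsum_congr fun a => by ring

theorem expect_add (p : PMF α) (f g : α → ℝ≥0∞) :
    (p.expect fun a => f a + g a) = p.expect f + p.expect g := by
  simp only [expect, mul_add, ENNReal.tsum_add]

theorem sum_expect (p : PMF α) (s : Finset ι) (f : ι → α → ℝ≥0∞) :
    ∑ i ∈ s, p.expect (f i) = p.expect fun a => ∑ i ∈ s, f i a := by
  simp only [expect, Finset.mul_sum]
  exact (Summable.tsum_finsetSum fun _ _ => ENNReal.summable).symm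

theorem expect_uniformOfFinset (s : Finset α) (hs : s.Nonempty) (f : α → ℝ≥0∞) :
    (PMF.uniformOfFinset s hs).expect f = (s.card : ℝ≥0∞)⁻¹ * ∑ a ∈ s, f a := by
  rw [expect, tsum_eq_sum (s := s), Finset.mul_sum]
  · exact Finset.sum_congr rfl fun a ha => by rw [PMF.uniformOfFinset_apply_of_mem hs ha]
  · intro a ha
    rw [PMF.uniformOfFinset_apply_of_notMem hs ha, zero_mul]

end PMF

theorem acceptProb_eq {α : Type} (f : α → Bool) (p : PMF α) :
    acceptProb f p = (p.expect fun a => if f a then 1 else 0).toReal := by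
  have h := (p.map f).expect_map id fun b => if b then (1 : ℝ≥0∞) else 0
  rw [PMF.map_id, PMF.expect_map] at h
  rw [acceptProb, ← PMF.expect_map p f fun b => if b then (1 : ℝ≥0∞) else 0]
  simp [PMF.expect]

end Expectation

/-! ### Regular graphs containing given edges, and the switching bound -/

section Regular

open scoped Classical

variable {V : Type} [Fintype V]

/-- The `d`-regular graphs on `V` that contain `H`. -/
noncomputable def regularAbove (d : ℕ) (H : SimpleGraph V) : Finset (SimpleGraph V) :=
  Finset.univ.filter fun G => (∀ v, (Finset.univ.filter (G.Adj v)).card = d) ∧ H ≤ G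

theorem mem_regularAbove {d : ℕ} {H G : SimpleGraph V} :
    G ∈ regularAbove d H ↔ (∀ v, (Finset.univ.filter (G.Adj v)).card = d) ∧ H ≤ G := by
  simp [regularAbove]

theorem regularAbove_anti {d : ℕ} {H H' : SimpleGraph V} (h : H ≤ H') :
    regularAbove d H' ⊆ regularAbove d H := fun G hG => by
  rw [mem_regularAbove] at *
  exact ⟨hG.1, h.trans hG.2⟩

theorem filter_regularAbove {d : ℕ} {H : SimpleGraph V} {v w : V} (h : v ≠ w) :
    (regularAbove d H).filter (fun G => G.Adj v w)
      = regularAbove d (H ⊔ SimpleGraph.edge v w) := by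
  ext G
  simp [mem_regularAbove, h, and_assoc]

theorem regularGraphs_eq (n d : ℕ) : regularGraphs n d = regularAbove d ⊥ := by
  ext G
  rw [mem_regularAbove, regularGraphs, Finset.mem_filter]
  simp only [Finset.mem_univ, true_and, bot_le, and_true, SimpleGraph.IsRegularOfDegree]
  refine forall_congr' fun v => ?_
  rw [← SimpleGraph.card_neighborFinset_eq_degree]
  have : G.neighborFinset v = Finset.univ.filter (G.Adj v) := by ext; simp
  rw [this]

theorem expect_randNeighbor {d : ℕ} (hd : 0 < d) {G : SimpleGraph V} {v : V}
    (hG : (Finset.univ.filter (G.Adj v)).card = d) (f : V → ℝ≥0∞) :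
    (randNeighbor G v).expect f = (d : ℝ≥0∞)⁻¹ * ∑ w, if G.Adj v w then f w else 0 := by
  have e : G.neighborFinset v = Finset.univ.filter (G.Adj v) := by ext; simp
  have hne : (G.neighborFinset v).Nonempty := by
    rw [← Finset.card_pos, e, hG]; exact hd
  rw [randNeighbor, dif_pos hne, PMF.expect_uniformOfFinset, e, hG, Finset.sum_filter]

theorem mem_support_randNeighbor {d : ℕ} (hd : 0 < d) {G : SimpleGraph V} {v w : V}
    (hG : (Finset.univ.filter (G.Adj v)).card = d) :
    w ∈ (randNeighbor G v).support ↔ G.Adj v w := by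
  have e : G.neighborFinset v = Finset.univ.filter (G.Adj v) := by ext; simp
  have hne : (G.neighborFinset v).Nonempty := by
    rw [← Finset.card_pos, e, hG]; exact hd
  rw [randNeighbor, dif_pos hne, PMF.mem_support_uniformOfFinset_iff]
  simp

/-- The graph obtained from `G` by replacing the edges `uv` and `xy` by `ux` and `vy`. -/
def switchEdges (G : SimpleGraph V) (u v x y : V) : SimpleGraph V :=
  SimpleGraph.fromEdgeSet ((G.edgeSet \ {s(u, v), s(x, y)}) ∪ {s(u, x), s(v, y)})

/-- Conditions under which the switch of `uv`, `xy` keeps the degrees. -/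
structure Switchable (G : SimpleGraph V) (u v x y : V) : Prop where
  uv : G.Adj u v
  xy : G.Adj x y
  xu : x ≠ u
  xv : x ≠ v
  yu : y ≠ u
  yv : y ≠ v
  ux : ¬ G.Adj u x
  vy : ¬ G.Adj v y

omit [Fintype V] in
theorem switchEdges_adj {G : SimpleGraph V} {u v x y : V} (h : Switchable G u v x y) (a b : V) :
    (switchEdges G u v x y).Adj a b ↔
      (G.Adj a b ∧ s(a, b) ≠ s(u, v) ∧ s(a, b) ≠ s(x, y)) ∨ s(a, b) = s(u, x) ∨
        s(a, b) = s(v, y) := by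
  have h1 := h.xu
  have h2 := h.yv
  have h3 : G.Adj a b → a ≠ b := fun h => h.ne
  simp only [switchEdges, SimpleGraph.fromEdgeSet_adj, Set.mem_union, Set.mem_sdiff,
    SimpleGraph.mem_edgeSet, Set.mem_insert_iff, Set.mem_singleton_iff, not_or]
  constructor
  · rintro ⟨h, -⟩; tauto
  · intro h
    refine ⟨by tauto, ?_⟩
    rcases h with h | h | h
    · exact h3 h.1
    · rintro rfl; grind
    · rintro rfl; grind

omit [Fintype V] in
theorem card_insert_erase_eq {s : Finset V} {a b : V} (ha : a ∈ s) (hb : b ∉ s) :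
    (insert b (s.erase a)).card = s.card := by
  rw [Finset.card_insert_of_notMem (by simp [hb]), Finset.card_erase_add_one ha]

theorem card_switchEdges {G : SimpleGraph V} {u v x y : V} (h : Switchable G u v x y) (z : V) :
    (Finset.univ.filter ((switchEdges G u v x y).Adj z)).card
      = (Finset.univ.filter (G.Adj z)).card := by
  obtain ⟨uv, xy, xu, xv, yu, yv, ux, vy⟩ := id h
  have huv := uv.ne
  have hxy := xy.ne
  have uv' := uv.symm
  have xy' := xy.symm
  have ux' : ¬ G.Adj x u := fun h => ux h.symm
  have vy' : ¬ G.Adj y v := fun h => vy h.symm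
  by_cases z1 : z = u
  · subst z1
    rw [← card_insert_erase_eq (s := Finset.univ.filter (G.Adj z)) (a := v) (b := x)
      (by simpa) (by simpa)]
    congr 1; ext b
    simp only [Finset.mem_filter, Finset.mem_univ, true_and, switchEdges_adj h,
      Finset.mem_insert, Finset.mem_erase, Sym2.eq_iff]
    grind
  by_cases z2 : z = v
  · subst z2
    rw [← card_insert_erase_eq (s := Finset.univ.filter (G.Adj z)) (a := u) (b := y)
      (by simpa) (by simpa)]
    congr 1; ext b
    simp only [Finset.mem_filter, Finset.mem_univ, true_and, switchEdges_adj h,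
      Finset.mem_insert, Finset.mem_erase, Sym2.eq_iff]
    grind
  by_cases z3 : z = x
  · subst z3
    rw [← card_insert_erase_eq (s := Finset.univ.filter (G.Adj z)) (a := y) (b := u)
      (by simpa) (by simpa)]
    congr 1; ext b
    simp only [Finset.mem_filter, Finset.mem_univ, true_and, switchEdges_adj h,
      Finset.mem_insert, Finset.mem_erase, Sym2.eq_iff]
    grind
  by_cases z4 : z = y
  · subst z4
    rw [← card_insert_erase_eq (s := Finset.univ.filter (G.Adj z)) (a := x) (b := v)
      (by simpa) (by simpa)]
    congr 1; ext b
    simp only [Finset.mem_filter, Finset.mem_univ, true_and, switchEdges_adj h,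
      Finset.mem_insert, Finset.mem_erase, Sym2.eq_iff]
    grind
  congr 1; ext b
  simp only [Finset.mem_filter, Finset.mem_univ, true_and, switchEdges_adj h, Sym2.eq_iff]
  grind

omit [Fintype V] in
-- The switch is undone by the reverse switch, so `G` is determined by its image and the four
-- vertices. This gives the injectivity in the switching bound.
theorem adj_of_switchEdges {G : SimpleGraph V} {u v x y : V} (h : Switchable G u v x y) (a b : V) :
    G.Adj a b ↔ ((switchEdges G u v x y).Adj a b ∧ s(a, b) ≠ s(u, x) ∧ s(a, b) ≠ s(v, y)) ∨
      s(a, b) = s(u, v) ∨ s(a, b) = s(x, y) := by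
  rw [switchEdges_adj h]
  have h1 : s(a, b) = s(u, v) → G.Adj a b := fun e => by
    rw [← SimpleGraph.mem_edgeSet, e]; exact h.uv
  have h2 : s(a, b) = s(x, y) → G.Adj a b := fun e => by
    rw [← SimpleGraph.mem_edgeSet, e]; exact h.xy
  have h3 : s(a, b) = s(u, x) → ¬ G.Adj a b := fun e => by
    rw [← SimpleGraph.mem_edgeSet, e]; exact h.ux
  have h4 : s(a, b) = s(v, y) → ¬ G.Adj a b := fun e => by
    rw [← SimpleGraph.mem_edgeSet, e]; exact h.vy
  tauto

theorem card_darts_fst {d : ℕ} {G : SimpleGraph V}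
    (hG : ∀ v, (Finset.univ.filter (G.Adj v)).card = d) (B : Finset V) :
    (Finset.univ.filter fun p : V × V => G.Adj p.1 p.2 ∧ p.1 ∈ B).card = B.card * d := by
  have : (Finset.univ.filter fun p : V × V => G.Adj p.1 p.2 ∧ p.1 ∈ B)
      = (B.sigma fun v => Finset.univ.filter (G.Adj v)).map
        (Equiv.sigmaEquivProd V V).toEmbedding := by
    ext ⟨a, b⟩
    simp [and_comm]
  rw [this, Finset.card_map, Finset.card_sigma, Finset.sum_congr rfl fun v _ => hG v]
  simp

theorem card_darts_snd {d : ℕ} {G : SimpleGraph V}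
    (hG : ∀ v, (Finset.univ.filter (G.Adj v)).card = d) (B : Finset V) :
    (Finset.univ.filter fun p : V × V => G.Adj p.1 p.2 ∧ p.2 ∈ B).card = B.card * d := by
  rw [← card_darts_fst hG B]
  refine Finset.card_equiv (Equiv.prodComm V V) fun p => ?_
  simp [G.adj_comm]

/-- Of the `|V| d` darts `(x, y)`, the bad ones start in `S`, in `{u, v}` or at a neighbour of `u`,
or end in `{u, v}` or at a neighbour of `v`. Each excluded vertex spoils `d` darts. -/
theorem card_switchable_ge {d : ℕ} {G : SimpleGraph V}
    (hG : ∀ v, (Finset.univ.filter (G.Adj v)).card = d) {u v : V} (huv : G.Adj u v)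
    (S : Finset V) :
    Fintype.card V * d ≤ (Finset.univ.filter fun p : V × V =>
      Switchable G u v p.1 p.2 ∧ p.1 ∉ S).card + (S.card + 2 * d + 4) * d := by
  set B₁ : Finset V := S ∪ ({u, v} ∪ Finset.univ.filter (G.Adj u))
  set B₂ : Finset V := {u, v} ∪ Finset.univ.filter (G.Adj v)
  have h1 : B₁.card ≤ S.card + (2 + d) := by
    refine (Finset.card_union_le _ _).trans (Nat.add_le_add_left ?_ _)
    refine (Finset.card_union_le _ _).trans (Nat.add_le_add Finset.card_le_two (hG u).le)
  have h2 : B₂.card ≤ 2 + d :=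
    (Finset.card_union_le _ _).trans (Nat.add_le_add Finset.card_le_two (hG v).le)
  have h3 := card_darts_fst hG Finset.univ
  have h4 := card_darts_fst hG B₁
  have h5 := card_darts_snd hG B₂
  have hsub : (Finset.univ.filter fun p : V × V => G.Adj p.1 p.2 ∧ p.1 ∈ Finset.univ) ⊆
      (Finset.univ.filter fun p : V × V => Switchable G u v p.1 p.2 ∧ p.1 ∉ S) ∪
      ((Finset.univ.filter fun p : V × V => G.Adj p.1 p.2 ∧ p.1 ∈ B₁) ∪
       (Finset.univ.filter fun p : V × V => G.Adj p.1 p.2 ∧ p.2 ∈ B₂)) := by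
    rintro ⟨x, y⟩ h
    simp only [Finset.mem_filter, Finset.mem_univ, true_and, and_true, Finset.mem_union,
      Finset.mem_insert, Finset.mem_singleton, B₁, B₂] at h ⊢
    by_cases hx : x ∈ S ∨ (x = u ∨ x = v) ∨ G.Adj u x
    · tauto
    by_cases hy : (y = u ∨ y = v) ∨ G.Adj v y
    · tauto
    push Not at hx hy
    exact Or.inl ⟨⟨huv, h, hx.2.1.1, hx.2.1.2, hy.1.1, hy.1.2, hx.2.2, hy.2⟩, hx.1⟩
  have h6 := (Finset.card_le_card hsub).trans ((Finset.card_union_le _ _).trans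
    (Nat.add_le_add_left (Finset.card_union_le _ _) _))
  rw [h3, h4, h5, Finset.card_univ] at h6
  nlinarith [Nat.mul_le_mul_right d h1, Nat.mul_le_mul_right d h2]

/-- Switching bound: a uniformly random `d`-regular graph that contains `H` contains a given
further edge with probability at most `2 d / |V|`. -/
theorem card_regularAbove_edge_le {d : ℕ} (hd : 0 < d) {H : SimpleGraph V} {S : Finset V}
    (hS : ∀ a b, H.Adj a b → a ∈ S) (hcard : 2 * (S.card + 2 * d + 4) ≤ Fintype.card V)
    {u v : V} (huv : u ≠ v) (hH : ¬ H.Adj u v) :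
    Fintype.card V * (regularAbove d (H ⊔ SimpleGraph.edge u v)).card
      ≤ 2 * d * (regularAbove d H).card := by
  set A := (regularAbove d (H ⊔ SimpleGraph.edge u v)).sigma fun G =>
    Finset.univ.filter fun p : V × V => Switchable G u v p.1 p.2 ∧ p.1 ∉ S
  set B := (regularAbove d H).sigma fun G =>
    (Finset.univ.filter (G.Adj u)) ×ˢ (Finset.univ.filter (G.Adj v))
  have hAB : A.card ≤ B.card := by
    -- Double counting: carrying the dart `(x, y)` along makes switching injective, and in the image
    -- `x` is a neighbour of `u` and `y` one of `v`, which leaves at most `d * d` darts per graph.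
    refine Finset.card_le_card_of_injOn
      (fun t => ⟨switchEdges t.1 u v t.2.1 t.2.2, t.2⟩) ?_ ?_
    · rintro ⟨G, x, y⟩ h
      simp only [A, Finset.coe_sigma, Set.mem_sigma_iff, Finset.mem_coe, mem_regularAbove,
        Finset.mem_filter, Finset.mem_univ, true_and] at h
      obtain ⟨⟨hreg, hle⟩, hsw, hx⟩ := h
      simp only [B, Finset.coe_sigma, Set.mem_sigma_iff, Finset.mem_coe, mem_regularAbove,
        Finset.mem_product, Finset.mem_filter, Finset.mem_univ, true_and]
      refine ⟨⟨fun z => (card_switchEdges hsw z).trans (hreg z), ?_⟩, ?_, ?_⟩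
      -- No edge of `H` is destroyed: `uv` is not in `H`, and `xy` is not because `x ∉ S`.
      · intro a b hab
        rw [switchEdges_adj hsw]
        refine Or.inl ⟨hle (Or.inl hab), fun e => hH ?_, fun e => hx ?_⟩
        · rw [← SimpleGraph.mem_edgeSet, ← e]; exact hab
        · have : H.Adj x y := by rw [← SimpleGraph.mem_edgeSet, ← e]; exact hab
          exact hS _ _ this
      · simp [switchEdges_adj hsw]
      · simp [switchEdges_adj hsw]
    · rintro ⟨G, x, y⟩ h ⟨G', x', y'⟩ h' e
      simp only [A, Finset.coe_sigma, Set.mem_sigma_iff, Finset.mem_coe, mem_regularAbove,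
        Finset.mem_filter, Finset.mem_univ, true_and] at h h'
      simp only [Sigma.mk.injEq, heq_eq_eq, Prod.mk.injEq] at e
      obtain ⟨e, rfl, rfl⟩ := e
      have : G = G' := by
        ext a b
        rw [adj_of_switchEdges h.2.1, adj_of_switchEdges h'.2.1, e]
      rw [this]
  have hB : B.card = (regularAbove d H).card * (d * d) := by
    rw [Finset.card_sigma, Finset.sum_congr rfl fun G hG => ?_, Finset.sum_const, smul_eq_mul]
    rw [Finset.card_product, (mem_regularAbove.1 hG).1, (mem_regularAbove.1 hG).1]
  -- By `hcard` at least half of the `|V| d` darts are usable; this is the source of the factor 2 in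
  -- the bound.
  have hA : (regularAbove d (H ⊔ SimpleGraph.edge u v)).card * (Fintype.card V * d)
      ≤ 2 * A.card := by
    rw [Finset.card_sigma, Finset.mul_sum, ← smul_eq_mul, ← Finset.sum_const]
    refine Finset.sum_le_sum fun G hG => ?_
    obtain ⟨hreg, hle⟩ := mem_regularAbove.1 hG
    have hadj : G.Adj u v := hle (Or.inr (by simp [SimpleGraph.edge_adj, huv]))
    have := card_switchable_ge hreg hadj S
    nlinarith [Nat.mul_le_mul_right d hcard]
  have : (Fintype.card V * (regularAbove d (H ⊔ SimpleGraph.edge u v)).card) * d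
      ≤ (2 * d * (regularAbove d H).card) * d := by
    nlinarith
  exact Nat.le_of_mul_le_mul_right this hd

end Regular

/-! ### Exploring a uniformly random regular graph by probes -/

section Exploration

open scoped Classical

variable {V : Type} [Fintype V]

/-- Exploration bound. `I b H` is an invariant of the set `H` of revealed edges when `b` probes are
left; it survives every newly revealed edge to a vertex outside a set of at most `σ` vertices.
If, given the revealed edges, the payoff `κ` of every result is at most `ε` on average over the
regular graphs that contain them, then each probe adds at most `σ * q` to this average. -/
theorem sum_expect_run_le [Nonempty V] {d : ℕ} (hd : 0 < d) {α : Type}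
    {I : ℕ → SimpleGraph V → Prop} {σ : ℕ} {q ε : ℝ≥0∞} (κ : SimpleGraph V → α → ℝ≥0∞)
    (hκ : ∀ G a, κ G a ≤ 1)
    (hmono : ∀ b H, I (b + 1) H → I b H)
    (hext : ∀ b H v, I (b + 1) H → ∃ S : Finset V, S.card ≤ σ ∧ ∀ w, w ∉ S → v ≠ w →
      ¬ H.Adj v w → I b (H ⊔ SimpleGraph.edge v w))
    (hq : ∀ b H, I b H → ∀ v w, v ≠ w → ¬ H.Adj v w →
      ((regularAbove d (H ⊔ SimpleGraph.edge v w)).card : ℝ≥0∞) ≤ q * (regularAbove d H).card)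
    (P : ProbeProgram V α) (b : ℕ) (H : SimpleGraph V) (hI : I b H)
    (hcost : ∀ G ∈ regularAbove d H, ∀ r ∈ (P.run G).support, r.2 ≤ b)
    (hε : ∀ H' a, H ≤ H' → I 0 H' →
      (∀ G ∈ regularAbove d H', ∃ c, (a, c) ∈ (P.run G).support) →
      ∑ G ∈ regularAbove d H', κ G a ≤ ε * (regularAbove d H').card) :
    ∑ G ∈ regularAbove d H, (P.run G).expect (fun r => κ G r.1)
      ≤ (ε + b * (σ * q)) * (regularAbove d H).card := by
  induction P generalizing b H with
  | ret a =>
    have hI0 : I 0 H := by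
      clear hcost
      induction b with
      | zero => exact hI
      | succ b ih => exact ih (hmono _ _ hI)
    simp only [ProbeProgram.run, PMF.expect_pure]
    refine (hε H a le_rfl hI0 fun G _ => ⟨0, by simp [ProbeProgram.run]⟩).trans ?_
    gcongr
    exact le_self_add
  | sample p next ih =>
    simp only [ProbeProgram.run, PMF.expect_bind]
    rw [PMF.sum_expect]
    refine p.expect_le_of_support fun i hi => ?_
    have hsup : ∀ G r, r ∈ ((next i).run G).support →
        r ∈ ((ProbeProgram.sample p next).run G).support := fun G r hr => by
      rw [ProbeProgram.run, PMF.mem_support_bind_iff]; exact ⟨i, hi, hr⟩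
    refine ih i b H hI (fun G hG r hr => hcost G hG r (hsup G r hr)) fun H' a hH hI' h => ?_
    refine hε H' a hH hI' fun G hG => ?_
    obtain ⟨c, hc⟩ := h G hG
    exact ⟨c, hsup G _ hc⟩
  | askVertex next ih =>
    have hsup : ∀ G w r, r ∈ ((next w).run G).support →
        (r.1, r.2 + 1) ∈ ((ProbeProgram.askVertex next).run G).support := fun G w r hr => by
      rw [ProbeProgram.run, PMF.mem_support_bind_iff]
      exact ⟨w, by simp, (PMF.mem_support_map_iff _ _ _).2 ⟨r, hr, rfl⟩⟩
    rcases (regularAbove d H).eq_empty_or_nonempty with h0 | ⟨G₀, hG₀⟩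
    · simp [h0]
    -- The budget is positive, since every run on `G₀` makes at least the present probe.
    obtain ⟨b, rfl⟩ : ∃ b', b = b' + 1 := by
      obtain ⟨r, hr⟩ := ((next (Classical.arbitrary V)).run G₀).support_nonempty
      have := hcost G₀ hG₀ _ (hsup G₀ _ r hr)
      exact ⟨b - 1, by omega⟩
    simp only [ProbeProgram.run, PMF.expect_bind, PMF.expect_map]
    rw [PMF.sum_expect]
    refine PMF.expect_le_of_support _ fun w _ => ?_
    refine (ih w b H (hmono _ _ hI) (fun G hG r hr => ?_) fun H' a hH hI' h => ?_).trans ?_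
    · exact Nat.le_of_succ_le_succ (hcost G hG _ (hsup G w r hr))
    · refine hε H' a hH hI' fun G hG => ?_
      obtain ⟨c, hc⟩ := h G hG
      exact ⟨c + 1, hsup G w _ hc⟩
    · gcongr
      exact Nat.le_succ b
  | askNeighbor v next ih =>
    have hsup : ∀ G ∈ regularAbove d H, ∀ w, G.Adj v w → ∀ r, r ∈ ((next w).run G).support →
        (r.1, r.2 + 1) ∈ ((ProbeProgram.askNeighbor v next).run G).support :=
      fun G hG w hw r hr => by
        rw [ProbeProgram.run, PMF.mem_support_bind_iff]
        exact ⟨w, (mem_support_randNeighbor hd ((mem_regularAbove.1 hG).1 v)).2 hw,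
          (PMF.mem_support_map_iff _ _ _).2 ⟨r, hr, rfl⟩⟩
    rcases (regularAbove d H).eq_empty_or_nonempty with h0 | ⟨G₀, hG₀⟩
    · simp [h0]
    obtain ⟨b, rfl⟩ : ∃ b', b = b' + 1 := by
      obtain ⟨w, hw⟩ := Finset.card_pos.1 (hd.trans_eq ((mem_regularAbove.1 hG₀).1 v).symm)
      obtain ⟨r, hr⟩ := ((next w).run G₀).support_nonempty
      have := hcost G₀ hG₀ _ (hsup G₀ hG₀ w (by simpa using hw) r hr)
      exact ⟨b - 1, by omega⟩
    obtain ⟨S, hSσ, hS⟩ := hext b H v hI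
    obtain ⟨N, hN⟩ : ∃ N : ℝ≥0∞, N = ((regularAbove d H).card : ℝ≥0∞) := ⟨_, rfl⟩
    rw [← hN]
    set B : ℝ≥0∞ := ε + b * (σ * q) with hB
    have key : ∀ w, ∑ G ∈ (regularAbove d H).filter (fun G => G.Adj v w),
        ((next w).run G).expect (fun r => κ G r.1)
        ≤ B * ((regularAbove d H).filter fun G => G.Adj v w).card
          + if w ∈ S then q * N else 0 := by
      intro w
      have hrec : ∀ H', H ≤ H' → I b H' → (∀ G ∈ regularAbove d H', G.Adj v w) →
          ∑ G ∈ regularAbove d H', ((next w).run G).expect (fun r => κ G r.1)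
            ≤ B * (regularAbove d H').card := by
        intro H' hHH hI' hadj
        refine ih w b H' hI' (fun G hG r hr => ?_) fun H'' a hH hI'' h => ?_
        · exact Nat.le_of_succ_le_succ (hcost G (regularAbove_anti hHH hG) _
            (hsup G (regularAbove_anti hHH hG) w (hadj G hG) r hr))
        · refine hε H'' a (hHH.trans hH) hI'' fun G hG => ?_
          obtain ⟨c, hc⟩ := h G hG
          have hG' := regularAbove_anti hH hG
          exact ⟨c + 1, hsup G (regularAbove_anti hHH hG') w (hadj G hG') _ hc⟩
      by_cases hadj : H.Adj v w
      · have hall : ∀ G ∈ regularAbove d H, G.Adj v w :=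
          fun G hG => (mem_regularAbove.1 hG).2 hadj
        rw [Finset.filter_true_of_mem hall]
        exact (hrec H le_rfl (hmono _ _ hI) hall).trans le_self_add
      by_cases hvw : v = w
      · subst hvw
        simp
      rw [filter_regularAbove hvw]
      -- A new edge into `S` breaks the invariant. The payoff is then bounded by 1, and the graphs
      -- with this edge are at most a fraction `q` of all.
      by_cases hw : w ∈ S
      · rw [if_pos hw, hN]
        refine le_trans ?_ ((hq _ _ hI v w hvw hadj).trans le_add_self)
        refine (Finset.sum_le_card_nsmul _ _ 1 fun G _ => ?_).trans (by simp)
        exact PMF.expect_le_of_support _ fun r _ => hκ _ _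
      · rw [if_neg hw, add_zero]
        refine hrec _ le_sup_left (hS w hw hvw hadj) fun G hG => ?_
        rw [← filter_regularAbove hvw, Finset.mem_filter] at hG
        exact hG.2
    have hdeg : ∑ w, (((regularAbove d H).filter fun G => G.Adj v w).card : ℝ≥0∞) = d * N := by
      have : ∑ w, ((regularAbove d H).filter fun G => G.Adj v w).card
          = (regularAbove d H).card * d := by
        rw [← smul_eq_mul, ← Finset.sum_const]
        simp only [Finset.card_filter]
        rw [Finset.sum_comm]
        refine Finset.sum_congr rfl fun G hG => ?_
        rw [← Finset.card_filter]
        exact (mem_regularAbove.1 hG).1 v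
      rw [hN, mul_comm]
      exact_mod_cast this
    have hd1 : (d : ℝ≥0∞)⁻¹ * d = 1 :=
      ENNReal.inv_mul_cancel (by exact_mod_cast hd.ne') (ENNReal.natCast_ne_top d)
    have hd2 : (d : ℝ≥0∞)⁻¹ ≤ 1 := ENNReal.inv_le_one.2 (by exact_mod_cast hd)
    calc ∑ G ∈ regularAbove d H, ((ProbeProgram.askNeighbor v next).run G).expect
          (fun r => κ G r.1)
        = ∑ G ∈ regularAbove d H, (d : ℝ≥0∞)⁻¹ * ∑ w, if G.Adj v w then
            ((next w).run G).expect (fun r => κ G r.1) else 0 := by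
          refine Finset.sum_congr rfl fun G hG => ?_
          simp only [ProbeProgram.run, PMF.expect_bind, PMF.expect_map]
          exact expect_randNeighbor hd ((mem_regularAbove.1 hG).1 v) _
      _ = (d : ℝ≥0∞)⁻¹ * ∑ w, ∑ G ∈ (regularAbove d H).filter (fun G => G.Adj v w),
            ((next w).run G).expect (fun r => κ G r.1) := by
          rw [← Finset.mul_sum, Finset.sum_comm]
          simp only [Finset.sum_filter]
      _ ≤ (d : ℝ≥0∞)⁻¹ * ∑ w, (B * ((regularAbove d H).filter fun G => G.Adj v w).card
          + if w ∈ S then q * N else 0) := by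
          gcongr with w
          exact key w
      _ = (d : ℝ≥0∞)⁻¹ * (B * (d * N) + S.card * (q * N)) := by
          rw [Finset.sum_add_distrib, ← Finset.mul_sum, hdeg]
          simp
      _ = ((d : ℝ≥0∞)⁻¹ * d) * (B * N) + (d : ℝ≥0∞)⁻¹ * (S.card * (q * N)) := by ring
      _ ≤ 1 * (B * N) + 1 * (σ * (q * N)) := by
          rw [hd1]
          gcongr
      _ = (ε + (b + 1 : ℕ) * (σ * q)) * N := by
          rw [hB]; push_cast; ring

/-- The exploration bound for a whole sequence of queries, each answered with at most `m`
probes. -/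
theorem sum_expect_runFrom_le [Nonempty V] {d : ℕ} (hd : 0 < d) (A : QueryAlgorithm V)
    {I : ℕ → SimpleGraph V → Prop} {σ m : ℕ} {q ε : ℝ≥0∞}
    (f : SimpleGraph V → List V → ℝ≥0∞)
    (hf : ∀ G l, f G l ≤ 1)
    (hmono : ∀ b H, I (b + 1) H → I b H)
    (hext : ∀ b H v, I (b + 1) H → ∃ S : Finset V, S.card ≤ σ ∧ ∀ w, w ∉ S → v ≠ w →
      ¬ H.Adj v w → I b (H ⊔ SimpleGraph.edge v w))
    (hq : ∀ b H, I b H → ∀ v w, v ≠ w → ¬ H.Adj v w →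
      ((regularAbove d (H ⊔ SimpleGraph.edge v w)).card : ℝ≥0∞) ≤ q * (regularAbove d H).card)
    (hε : ∀ H l, I 0 H → ∑ G ∈ regularAbove d H, f G l ≤ ε * (regularAbove d H).card)
    (Q : List ℕ) (x : A.State) (H : SimpleGraph V) (hI : I (Q.length * m) H)
    (hcost : ∀ G ∈ regularAbove d H, ∀ out ∈ (A.runFrom G x Q).support, ∀ r ∈ out, r.2 ≤ m) :
    ∑ G ∈ regularAbove d H, (A.runFrom G x Q).expect (fun out => f G (out.map Prod.fst))
      ≤ (ε + (Q.length * m : ℕ) * (σ * q)) * (regularAbove d H).card := by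
  induction Q generalizing f x H with
  | nil =>
    simp only [QueryAlgorithm.runFrom, PMF.expect_pure]
    simpa using hε H [] (by simpa using hI)
  | cons t Q ih =>
    simp only [QueryAlgorithm.runFrom, PMF.expect_bind, PMF.expect_map]
    have hlen : (t :: Q).length * m = m + Q.length * m := by simp; ring
    have hsup : ∀ G r rest, r ∈ ((A.answer x t).run G).support →
        rest ∈ (A.runFrom G r.1.2 Q).support →
        (r.1.1, r.2) :: rest ∈ (A.runFrom G x (t :: Q)).support := fun G r rest hr hrest => by
      rw [QueryAlgorithm.runFrom, PMF.mem_support_bind_iff]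
      exact ⟨r, hr, (PMF.mem_support_map_iff _ _ _).2 ⟨rest, hrest, rfl⟩⟩
    -- The invariant is shifted by the probes reserved for the remaining queries, and their loss is
    -- already included in `ε`.
    refine (sum_expect_run_le hd (I := fun b => I (b + Q.length * m)) (σ := σ) (q := q)
      (ε := ε + (Q.length * m : ℕ) * (σ * q))
      (fun G a => (A.runFrom G a.2 Q).expect fun out => f G (a.1 :: out.map Prod.fst))
      ?_ ?_ ?_ ?_ (A.answer x t) m H ?_ ?_ ?_).trans ?_
    · exact fun G a => PMF.expect_le_of_support _ fun _ _ => hf _ _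
    · intro b H h
      refine hmono _ _ ?_
      rwa [add_right_comm] at h
    · intro b H v h
      refine hext _ _ _ ?_
      rwa [add_right_comm] at h
    · exact fun b H h => hq _ _ h
    · rwa [hlen] at hI
    · intro G hG r hr
      obtain ⟨rest, hrest⟩ := (A.runFrom G r.1.2 Q).support_nonempty
      exact hcost G hG _ (hsup G r rest hr hrest) (r.1.1, r.2) (by simp)
    -- The probe bound is known only along possible runs; `hreach` makes the new state `x'`
    -- reachable on every graph still considered.
    · rintro H' ⟨v, x'⟩ hH hI' hreach
      refine ih (fun G l => f G (v :: l)) (fun G l => hf _ _) (fun H l h => ?_) x' H' ?_ ?_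
      · exact hε H (v :: l) h
      · simpa using hI'
      · intro G hG out hout r hr
        obtain ⟨c, hc⟩ := hreach G hG
        exact hcost G (regularAbove_anti hH hG) _ (hsup G _ out hc hout) r (by simp [hr])
    · rw [hlen]
      push_cast
      gcongr ?_ * _
      apply le_of_eq
      ring

end Exploration

/-! ### Nonbacktracking walks and reduction of walks -/

section NonBacktracking

open scoped Classical

variable {V : Type}

/-- A list of successively adjacent vertices without a segment `a, b, a`. -/
def NonBacktracking (H : SimpleGraph V) : List V → Prop
  | [] => True
  | [_] => True
  | a :: b :: r => H.Adj a b ∧ r.head? ≠ some a ∧ NonBacktracking H (b :: r)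

theorem NonBacktracking.tail {H : SimpleGraph V} {a b : V} {r : List V}
    (h : NonBacktracking H (a :: b :: r)) : NonBacktracking H (b :: r) := h.2.2

/-- A nonbacktracking list never visits a pendant vertex in its interior. -/
theorem NonBacktracking.of_pendant {H : SimpleGraph V} {v w : V}
    (hw : ∀ a, ¬ H.Adj a w) {a : V} {l : List V}
    (h : NonBacktracking (H ⊔ SimpleGraph.edge v w) (a :: l)) (ha : a ≠ w)
    (hlast : (a :: l).getLast? ≠ some w) : NonBacktracking H (a :: l) := by
  induction l generalizing a with
  | nil => trivial
  | cons b r ih =>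
    obtain ⟨hab, hr, hbr⟩ := h
    have hadj : ∀ x y, (H ⊔ SimpleGraph.edge v w).Adj x y →
        H.Adj x y ∨ (x = v ∧ y = w) ∨ (x = w ∧ y = v) := fun x y h => by
      rcases h with h | h
      · exact Or.inl h
      · right
        have := (SimpleGraph.edge_adj v w x y).1 h
        tauto
    have hb : b ≠ w := by
      rintro rfl
      have hav : a = v := by
        rcases hadj _ _ hab with h | h | h
        · exact absurd h (hw a)
        · exact h.1
        · exact absurd h.1 ha
      cases r with
      | nil => simp at hlast
      | cons c r =>
        have hcv : c = v := by
          rcases hadj _ _ hbr.1 with h | h | h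
          · exact absurd h.symm (hw c)
          · exact absurd (h.2.symm ▸ hbr.1) (SimpleGraph.irrefl _)
          · exact h.2
        exact hr (by simp [hav, hcv])
    refine ⟨?_, hr, ih hbr hb (by simpa using hlast)⟩
    rcases hadj _ _ hab with h | h | h
    · exact h
    · exact absurd h.2 hb
    · exact absurd h.1 ha

/-- Appending `x` at the head of a reduced walk, cancelling a backtracking step. -/
noncomputable def pushVertex : List V → V → List V
  | a :: b :: r, x => if x = b then b :: r else x :: a :: b :: r
  | l, x => x :: l

/-- The reduced form (last vertex first) of the walk `st` followed by the first `l` steps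
of `p`. -/
noncomputable def reduceFrom : List V → (ℕ → V) → ℕ → List V
  | st, _, 0 => st
  | st, p, l + 1 => reduceFrom (pushVertex st (p 1)) (fun t => p (t + 1)) l

theorem NonBacktracking.push {H : SimpleGraph V} {a x : V} {r : List V}
    (h : NonBacktracking H (a :: r)) (hx : H.Adj a x) :
    NonBacktracking H (pushVertex (a :: r) x) := by
  cases r with
  | nil => exact ⟨hx.symm, by simp, trivial⟩
  | cons b r =>
    rw [pushVertex]
    split_ifs with hb
    · exact h.tail
    · exact ⟨hx.symm, by simpa using Ne.symm hb, h⟩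

theorem head?_pushVertex (l : List V) (x : V) : (pushVertex l x).head? = some x := by
  match l with
  | [] => rfl
  | [a] => rfl
  | a :: b :: r =>
    rw [pushVertex]
    split_ifs with hb
    · simp [hb]
    · rfl

theorem getLast?_pushVertex (a : V) (r : List V) (x : V) :
    (pushVertex (a :: r) x).getLast? = (a :: r).getLast? := by
  cases r with
  | nil => simp [pushVertex]
  | cons b r =>
    rw [pushVertex]
    split_ifs with hb <;> simp

theorem NonBacktracking.reduceFrom {H : SimpleGraph V} {st : List V} {p : ℕ → V} {l : ℕ}
    (h : NonBacktracking H st) (hst : st.head? = some (p 0))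
    (hp : ∀ i < l, H.Adj (p i) (p (i + 1))) :
    NonBacktracking H (reduceFrom st p l) ∧ (reduceFrom st p l).head? = some (p l) ∧
      (reduceFrom st p l).getLast? = st.getLast? := by
  induction l generalizing st p with
  | zero => exact ⟨h, hst, rfl⟩
  | succ l ih =>
    cases st with
    | nil => simp at hst
    | cons a r =>
      obtain rfl : a = p 0 := by simpa using hst
      have := ih (st := pushVertex (p 0 :: r) (p 1)) (p := fun t => p (t + 1))
        (h.push (hp 0 (Nat.succ_pos l))) (head?_pushVertex _ _)
        (fun i hi => hp (i + 1) (Nat.succ_lt_succ hi))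
      rwa [getLast?_pushVertex] at this

end NonBacktracking

/-! ### The random walk has a long reduced form -/

section Walk

open scoped Classical

variable {V : Type} [Fintype V]

theorem randomWalk_support {d : ℕ} (hd : 0 < d) {G : SimpleGraph V}
    (hG : ∀ v, (Finset.univ.filter (G.Adj v)).card = d) {l : ℕ} {v : V} {p : ℕ → V}
    (hp : p ∈ (randomWalk G l v).support) :
    p 0 = v ∧ ∀ i < l, G.Adj (p i) (p (i + 1)) := by
  induction l generalizing v p with
  | zero =>
    rw [randomWalk, PMF.mem_support_pure_iff] at hp
    simp [hp]
  | succ l ih =>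
    rw [randomWalk, PMF.mem_support_bind_iff] at hp
    obtain ⟨w, hw, hp⟩ := hp
    obtain ⟨p', hp', rfl⟩ := (PMF.mem_support_map_iff _ _ _).1 hp
    obtain ⟨h0, hadj⟩ := ih hp'
    refine ⟨rfl, fun i hi => ?_⟩
    cases i with
    | zero =>
      rw [mem_support_randNeighbor hd (hG v)] at hw
      simpa [h0] using hw
    | succ i => exact hadj i (Nat.lt_of_succ_lt_succ hi)

/-- With `θ = 2/3`, close to the minimiser `1/√2` of `(2/3) θ + (1/3) θ⁻¹`, this factor is `17/18`.
The number `5/9 = 1 - θ ^ 2` is the extra potential of a cancelling step. -/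
theorem ennreal_drift : (ENNReal.ofReal (2 / 3)) ^ 2 + ENNReal.ofReal (5 / 9) = 1 ∧
    ENNReal.ofReal (2 / 3) ^ 2 + 3⁻¹ * ENNReal.ofReal (5 / 9)
      ≤ ENNReal.ofReal (17 / 18) * ENNReal.ofReal (2 / 3) := by
  have h3 : (3 : ℝ≥0∞)⁻¹ = ENNReal.ofReal (1 / 3) := by
    rw [one_div, ENNReal.ofReal_inv_of_pos (by norm_num)]; simp
  rw [h3, ← ENNReal.ofReal_pow (by norm_num), ← ENNReal.ofReal_mul (by norm_num),
    ← ENNReal.ofReal_mul (by norm_num), ← ENNReal.ofReal_add (by norm_num) (by norm_num),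
    ← ENNReal.ofReal_add (by norm_num) (by norm_num), ← ENNReal.ofReal_one]
  constructor
  · norm_num
  · exact ENNReal.ofReal_le_ofReal (by norm_num)

/-- Only the one vertex below the top of the list cancels, with probability at most `1/d ≤ 1/3`. A
list of one vertex always grows, which gives the even better factor `2/3`. -/
theorem expect_step_le {d : ℕ} (hd : 3 ≤ d) {G : SimpleGraph V} {v : V}
    (hG : (Finset.univ.filter (G.Adj v)).card = d) {st : List V} (hst : st.head? = some v) :
    (randNeighbor G v).expect (fun w => ENNReal.ofReal (2 / 3) ^ (pushVertex st w).length)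
      ≤ ENNReal.ofReal (17 / 18) * ENNReal.ofReal (2 / 3) ^ st.length := by
  obtain ⟨h1, h2⟩ := ennreal_drift
  obtain ⟨θ, hθ⟩ : ∃ θ : ℝ≥0∞, θ = ENNReal.ofReal (2 / 3) := ⟨_, rfl⟩
  obtain ⟨c, hc⟩ : ∃ c : ℝ≥0∞, c = ENNReal.ofReal (5 / 9) := ⟨_, rfl⟩
  obtain ⟨ρ, hρ⟩ : ∃ ρ : ℝ≥0∞, ρ = ENNReal.ofReal (17 / 18) := ⟨_, rfl⟩
  have hθρ : θ ≤ ρ := by rw [hθ, hρ]; exact ENNReal.ofReal_le_ofReal (by norm_num)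
  rw [← hθ, ← hc] at h1 h2
  rw [← hρ] at h2 ⊢
  rw [← hθ]
  match st with
  | [] => simp at hst
  | [a] =>
    simp only [pushVertex, List.length_cons, List.length_nil]
    rw [PMF.expect_const, pow_succ']
    gcongr
  | a :: b :: r =>
    have hlen : ∀ w, θ ^ (pushVertex (a :: b :: r) w).length
        = θ ^ (r.length + 1) * (θ ^ 2 + if w = b then c else 0) := by
      intro w
      rw [pushVertex]
      split_ifs with h
      · simp [h1]
      · rw [add_zero, ← pow_add]; rfl
    simp only [hlen]
    rw [PMF.expect_const_mul, PMF.expect_add, PMF.expect_const]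
    have hb : (randNeighbor G v).expect (fun w => if w = b then c else 0) ≤ 3⁻¹ * c := by
      rw [expect_randNeighbor (by omega) hG]
      gcongr
      · exact_mod_cast hd
      · calc ∑ w, (if G.Adj v w then if w = b then c else 0 else 0)
            ≤ ∑ w, if w = b then c else 0 := by
              gcongr with w
              split_ifs <;> simp
          _ = c := by simp
    calc θ ^ (r.length + 1) * (θ ^ 2 + (randNeighbor G v).expect fun w => if w = b then c else 0)
        ≤ θ ^ (r.length + 1) * (ρ * θ) := by
          gcongr
          exact (add_le_add_right hb _).trans h2
      _ = ρ * θ ^ (a :: b :: r).length := by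
          simp only [List.length_cons]; ring

theorem expect_reduceFrom_le {d : ℕ} (hd : 3 ≤ d) {G : SimpleGraph V}
    (hG : ∀ v, (Finset.univ.filter (G.Adj v)).card = d) (l : ℕ) {v : V} {st : List V}
    (hst : st.head? = some v) :
    (randomWalk G l v).expect (fun p => ENNReal.ofReal (2 / 3) ^ (reduceFrom st p l).length)
      ≤ ENNReal.ofReal (17 / 18) ^ l * ENNReal.ofReal (2 / 3) ^ st.length := by
  induction l generalizing v st with
  | zero => simp [randomWalk, PMF.expect_pure, reduceFrom]
  | succ l ih =>
    rw [randomWalk, PMF.expect_bind]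
    calc (randNeighbor G v).expect (fun w => ((randomWalk G l w).map
            fun path t => Nat.casesOn t v path).expect
            fun p => ENNReal.ofReal (2 / 3) ^ (reduceFrom st p (l + 1)).length)
        ≤ (randNeighbor G v).expect (fun w => ENNReal.ofReal (17 / 18) ^ l *
            ENNReal.ofReal (2 / 3) ^ (pushVertex st w).length) := by
          refine PMF.expect_mono_support _ fun w _ => ?_
          rw [PMF.expect_map]
          refine (PMF.expect_mono_support _ fun p hp => ?_).trans
            (ih (v := w) (head?_pushVertex st w))
          have h0 := (randomWalk_support (by omega) hG hp).1
          change ENNReal.ofReal (2 / 3) ^ (reduceFrom (pushVertex st (p 0)) p l).length ≤ _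
          rw [h0]
      _ ≤ ENNReal.ofReal (17 / 18) ^ l *
            (ENNReal.ofReal (17 / 18) * ENNReal.ofReal (2 / 3) ^ st.length) := by
          rw [PMF.expect_const_mul]
          gcongr
          exact expect_step_le hd (hG v) hst
      _ = _ := by ring

/-- The acceptance test: the answers are positions of a walk of length `e` from `v₀` whose reduced
form has more than `m + 1` vertices. -/
def IsLongWalk (G : SimpleGraph V) (v₀ : V) (e m : ℕ) (Q : List ℕ) (out : List V) : Prop :=
  ∃ p : ℕ → V, p 0 = v₀ ∧ (∀ i < e, G.Adj (p i) (p (i + 1))) ∧ out = Q.map p ∧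
    m + 1 < (reduceFrom [v₀] p e).length

/-- Markov's inequality for the potential `(2/3) ^ length`. The initial list `[v₀]` contributes one
factor `2/3`, which turns the exponent `m + 1` into `m`. -/
theorem acceptProb_walkPositions_ge {d : ℕ} (hd : 3 ≤ d) {G : SimpleGraph V}
    (hG : ∀ v, (Finset.univ.filter (G.Adj v)).card = d) (v₀ : V) (m : ℕ) (Q : List ℕ) :
    1 - (3 / 2) ^ m * (17 / 18) ^ (Q.foldr max 0)
      ≤ acceptProb (fun out => decide (IsLongWalk G v₀ (Q.foldr max 0) m Q out))
          (walkPositions G v₀ Q) := by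
  set e := Q.foldr max 0
  rw [acceptProb_eq, walkPositions, PMF.expect_map]
  set X := (randomWalk G e v₀).expect fun p =>
    if decide (IsLongWalk G v₀ e m Q (Q.map p)) = true then (1 : ℝ≥0∞) else 0
  have hX1 : X ≤ 1 := PMF.expect_le_of_support _ fun p _ => by split_ifs <;> simp
  have hinv : ENNReal.ofReal (3 / 2) * ENNReal.ofReal (2 / 3) = 1 := by
    rw [← ENNReal.ofReal_mul (by norm_num)]; norm_num
  have hexp := expect_reduceFrom_le hd hG e (v := v₀) (st := [v₀]) rfl
  have hle : 1 ≤ X + ENNReal.ofReal (3 / 2) ^ (m + 1) * (ENNReal.ofReal (17 / 18) ^ e *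
      ENNReal.ofReal (2 / 3) ^ [v₀].length) := by
    calc (1 : ℝ≥0∞) = (randomWalk G e v₀).expect fun _ => 1 := (PMF.expect_const _ 1).symm
      _ ≤ (randomWalk G e v₀).expect fun p =>
          (if decide (IsLongWalk G v₀ e m Q (Q.map p)) = true then (1 : ℝ≥0∞) else 0) +
            ENNReal.ofReal (3 / 2) ^ (m + 1) *
              ENNReal.ofReal (2 / 3) ^ (reduceFrom [v₀] p e).length := by
          refine PMF.expect_mono_support _ fun p hp => ?_
          obtain ⟨h0, hadj⟩ := randomWalk_support (by omega) hG hp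
          by_cases hlong : m + 1 < (reduceFrom [v₀] p e).length
          · have : IsLongWalk G v₀ e m Q (Q.map p) := ⟨p, h0, hadj, rfl, hlong⟩
            simp [this]
          · refine le_trans ?_ le_add_self
            obtain ⟨j, hj⟩ := Nat.exists_eq_add_of_le (not_lt.1 hlong)
            rw [hj, pow_add, mul_right_comm, ← mul_pow, hinv, one_pow, one_mul]
            exact one_le_pow₀ (ENNReal.one_le_ofReal.2 (by norm_num))
      _ ≤ _ := by
          rw [PMF.expect_add, PMF.expect_const_mul]
          gcongr
  have hfin : ENNReal.ofReal (3 / 2) ^ (m + 1) * (ENNReal.ofReal (17 / 18) ^ e *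
      ENNReal.ofReal (2 / 3) ^ [v₀].length)
      = ENNReal.ofReal ((3 / 2) ^ m * (17 / 18) ^ e) := by
    rw [List.length_singleton, pow_one, pow_succ,
      ENNReal.ofReal_mul (by positivity), ENNReal.ofReal_pow (by norm_num),
      ENNReal.ofReal_pow (by norm_num)]
    calc _ = ENNReal.ofReal (3 / 2) ^ m * ENNReal.ofReal (17 / 18) ^ e *
        (ENNReal.ofReal (3 / 2) * ENNReal.ofReal (2 / 3)) := by ring
      _ = _ := by rw [hinv, mul_one]
  rw [hfin] at hle
  have h2 := ENNReal.toReal_mono (ENNReal.add_ne_top.2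
    ⟨(hX1.trans_lt ENNReal.one_lt_top).ne, ENNReal.ofReal_ne_top⟩) hle
  rw [ENNReal.toReal_add (hX1.trans_lt ENNReal.one_lt_top).ne ENNReal.ofReal_ne_top,
    ENNReal.toReal_ofReal (by positivity), ENNReal.toReal_one] at h2
  linarith

end Walk

/-! ### Existence of regular graphs -/

section Existence

/-- A circulant graph works: join vertices whose difference is one of `±1, …, ±⌊d/2⌋`, and also
antipodal vertices if `d` is odd, when `n` must be even. -/
theorem nonempty_regularGraphs {n d : ℕ} [NeZero n] (hd : d < n) (hn : Even (n * d)) :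
    (regularGraphs n d).Nonempty := by
  classical
  have hpos : 0 < n := NeZero.pos n
  obtain ⟨P, hP⟩ : ∃ P : ℕ → Prop, P = fun t => 0 < t ∧
      (t ≤ d / 2 ∨ n - d / 2 ≤ t ∨ (d % 2 = 1 ∧ 2 * t = n)) := ⟨_, rfl⟩
  have hneg : ∀ z : Fin n, P z.val → P (-z).val := by
    intro z hz
    have hlt := z.isLt
    have hz0 : 0 < z.val := by rw [hP] at hz; exact hz.1
    rw [Fin.val_neg', Nat.mod_eq_of_lt (by omega)]
    rw [hP] at hz ⊢
    obtain ⟨-, h⟩ := hz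
    refine ⟨by omega, ?_⟩
    omega
  let G : SimpleGraph (Fin n) :=
    { Adj := fun a b => P (b - a).val
      symm := ⟨fun a b h => by simpa using hneg _ h⟩
      loopless := ⟨fun a h => by simp [hP] at h⟩ }
  have hcount : ((Finset.range n).filter P).card = d := by
    rcases Nat.even_or_odd' d with ⟨j, rfl | rfl⟩
    · have : (Finset.range n).filter P = Finset.Icc 1 j ∪ Finset.Ico (n - j) n := by
        ext t; simp [hP]; omega
      rw [this, Finset.card_union_of_disjoint]
      · simp; omega
      · rw [Finset.disjoint_left]; intro t; simp; omega
    · have hne : n % 2 = 0 := by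
        rcases Nat.even_mul.1 hn with h | h
        · exact Nat.even_iff.1 h
        · exact absurd (Nat.even_iff.1 h) (by omega)
      have : (Finset.range n).filter P
          = insert (n / 2) (Finset.Icc 1 j ∪ Finset.Ico (n - j) n) := by
        ext t; simp [hP]; omega
      rw [this, Finset.card_insert_of_notMem, Finset.card_union_of_disjoint]
      · simp; omega
      · rw [Finset.disjoint_left]; intro t; simp; omega
      · simp; omega
  refine ⟨G, ?_⟩
  rw [regularGraphs_eq, mem_regularAbove]
  refine ⟨fun v => ?_, bot_le⟩
  rw [← hcount]
  refine Finset.card_bij (fun b _ => (b - v).val) ?_ ?_ ?_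
  · intro b hb
    simpa [G] using hb
  · intro a _ b _ h
    simpa using Fin.ext h
  · intro t ht
    rw [Finset.mem_filter, Finset.mem_range] at ht
    refine ⟨⟨t, ht.1⟩ + v, ?_, ?_⟩
    · simpa [G] using ht.2
    · simp

end Existence

/-! ### Every algorithm with few probes fails the test -/

section LowerBound

open scoped Classical

variable {V : Type} [Fintype V]

omit [Fintype V] in
theorem adj_sup_edge_mem {H : SimpleGraph V} {S : Finset V} (hS : ∀ a b, H.Adj a b → a ∈ S)
    (v w a b : V) (h : (H ⊔ SimpleGraph.edge v w).Adj a b) : a ∈ insert v (insert w S) := by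
  rcases h with h | h
  · simp [hS _ _ h]
  · rw [SimpleGraph.edge_adj] at h
    rcases h.1 with h | h <;> simp [h.1]

omit [Fintype V] in
/-- If all revealed nonbacktracking walks from `v₀` to `p e` are short, then a walk with a long
reduced form uses an unrevealed edge. -/
theorem length_reduceFrom_le {H : SimpleGraph V} {v₀ : V} {e m : ℕ} {p : ℕ → V} (he : 2 ≤ e)
    (h0 : p 0 = v₀)
    (hnb : ∀ l, NonBacktracking H l → l.head? = some (p e) → l.getLast? = some v₀ →
      l.length ≤ m + 1)
    (hadj : ∀ i, 2 ≤ i → i < e → H.Adj (p i) (p (i + 1)))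
    (h : p 2 = v₀ ∨ (H.Adj v₀ (p 1) ∧ H.Adj (p 1) (p 2))) :
    (reduceFrom [v₀] p e).length ≤ m + 1 := by
  subst h0
  rcases h with h | ⟨h1, h2⟩
  -- The first two steps go out and back, so they cancel whether or not their edge has been
  -- revealed.
  · obtain ⟨e, rfl⟩ : ∃ e', e = e' + 2 := ⟨e - 2, by omega⟩
    have hred : reduceFrom [p 0] p (e + 2) = reduceFrom [p 0] (fun t => p (t + 2)) e := by
      simp [reduceFrom, pushVertex, h]
    obtain ⟨g1, g2, g3⟩ := NonBacktracking.reduceFrom (H := H) (st := [p 0])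
      (p := fun t => p (t + 2)) (l := e) trivial (by simp [h])
      (fun i hi => hadj (i + 2) (by omega) (by omega))
    rw [hred]
    exact hnb _ g1 g2 g3
  · obtain ⟨g1, g2, g3⟩ := NonBacktracking.reduceFrom (H := H) (st := [p 0])
      (p := p) (l := e) trivial rfl (fun i hi => by
        rcases i with _ | _ | i
        · exact h1
        · exact h2
        · exact hadj _ (by omega) hi)
    exact hnb _ g1 g2 g3

/-- If all revealed nonbacktracking walks from `v₀` to the answer `x` at time `e` are short, then
any fixed list of answers is unlikely to pass the test. -/
theorem sum_isLongWalk_le {d : ℕ} {q : ℝ≥0∞}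
    (hq : ∀ (H : SimpleGraph V) (S : Finset V), (∀ a b, H.Adj a b → a ∈ S) →
      2 * (S.card + 2 * d + 4) ≤ Fintype.card V → ∀ v w, v ≠ w → ¬ H.Adj v w →
      ((regularAbove d (H ⊔ SimpleGraph.edge v w)).card : ℝ≥0∞) ≤ q * (regularAbove d H).card)
    {H : SimpleGraph V} {S : Finset V} (hS : ∀ a b, H.Adj a b → a ∈ S)
    (hcard : 2 * (S.card + 1 + 2 * d + 4) ≤ Fintype.card V) {v₀ x : V} (hv₀ : v₀ ∈ S)
    {e m s : ℕ} (he : 3 ≤ e) (hs : s = 1 ∨ s = 2)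
    (hnb : ∀ l, NonBacktracking H l → l.head? = some x → l.getLast? = some v₀ →
      l.length ≤ m + 1) (l : List V) :
    ∑ G ∈ regularAbove d H,
      (if IsLongWalk G v₀ e m (e :: List.Ico s e) (x :: l) then (1 : ℝ≥0∞) else 0)
      ≤ (q + S.card * q + Fintype.card V * q ^ 2) * (regularAbove d H).card := by
  set N : ℝ≥0∞ := ((regularAbove d H).card : ℝ≥0∞) with hN
  rw [Finset.sum_boole]
  set T := (regularAbove d H).filter fun G =>
    IsLongWalk G v₀ e m (e :: List.Ico s e) (x :: l) with hT
  rcases T.eq_empty_or_nonempty with h0 | ⟨G₀, hG₀⟩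
  · simp [h0]
  obtain ⟨p₀, hp₀, hadj₀, hout₀, -⟩ := (Finset.mem_filter.1 hG₀).2
  have hx : x = p₀ e := by simpa using (List.cons.inj hout₀).1
  -- The fixed answers determine the positions at times `2, …, e`. The position at time 1 may depend
  -- on `G`, because it is not asked when `s = 2`.
  have hpath : ∀ G ∈ T, G ∈ regularAbove d H ∧ ∃ p : ℕ → V, p 0 = v₀ ∧ p e = x ∧
      (∀ i, 2 ≤ i → i ≤ e → p i = p₀ i) ∧
      (∀ i < e, G.Adj (p i) (p (i + 1))) ∧ m + 1 < (reduceFrom [v₀] p e).length := by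
    intro G hG
    obtain ⟨hGH, p, hp, hadj, hout, hlen⟩ := Finset.mem_filter.1 hG
    have hpe : p e = x := by simpa using (List.cons.inj hout).1.symm
    refine ⟨hGH, p, hp, hpe, fun i hi hie => ?_, hadj, hlen⟩
    rcases hie.lt_or_eq with h | rfl
    · have h1 := (List.cons.inj hout₀).2.symm.trans (List.cons.inj hout).2
      exact (List.map_inj_left.1 h1 i (by rw [List.Ico.mem]; omega)).symm
    · rw [hpe, hx]
  -- If a step from time 2 on uses an unrevealed edge, this edge is the same for all accepting
  -- graphs and costs one factor `q`.
  by_cases hall : ∀ i, 2 ≤ i → i < e → H.Adj (p₀ i) (p₀ (i + 1))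
  swap
  · push Not at hall
    obtain ⟨i, hi, hie, hnadj⟩ := hall
    have hsub : T ⊆ regularAbove d (H ⊔ SimpleGraph.edge (p₀ i) (p₀ (i + 1))) := by
      intro G hG
      obtain ⟨hGH, p, -, -, hpp, hadj, -⟩ := hpath G hG
      rw [← filter_regularAbove (hadj₀ i hie).ne, Finset.mem_filter]
      refine ⟨hGH, ?_⟩
      rw [← hpp i hi hie.le, ← hpp (i + 1) (by omega) hie]
      exact hadj i hie
    calc (T.card : ℝ≥0∞) ≤ (regularAbove d (H ⊔ SimpleGraph.edge (p₀ i) (p₀ (i + 1)))).card := by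
          exact_mod_cast Finset.card_le_card hsub
      _ ≤ q * N := hq H S hS (by omega) _ _ (hadj₀ i hie).ne hnadj
      _ ≤ _ := by
          gcongr
          rw [add_assoc]
          exact le_self_add
  -- Otherwise one of the first two steps is unrevealed. The union bound over the midpoint `z` gives
  -- `|S| q` for `z ∈ S`, with at least one new edge, and `|V| q ^ 2` for `z ∉ S`, with two distinct
  -- new edges.
  · have hlong : ∀ G ∈ T, p₀ 2 ≠ v₀ ∧ ∃ z, G.Adj v₀ z ∧ G.Adj z (p₀ 2) ∧
        ¬ (H.Adj v₀ z ∧ H.Adj z (p₀ 2)) := by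
      intro G hG
      obtain ⟨hGH, p, hp, hpe, hpp, hadj, hlen⟩ := hpath G hG
      have h2 := hpp 2 le_rfl (by omega)
      have hnot : ¬ (p 2 = v₀ ∨ (H.Adj v₀ (p 1) ∧ H.Adj (p 1) (p 2))) := fun h => by
        refine absurd (length_reduceFrom_le (by omega) hp ?_ ?_ h) hlen.not_ge
        · rwa [hpe]
        · intro i hi hie
          rw [hpp i hi hie.le, hpp (i + 1) (by omega) hie]
          exact hall i hi hie
      rw [h2] at hnot
      push Not at hnot
      refine ⟨hnot.1, p 1, ?_, ?_, fun h => hnot.2 h.1 h.2⟩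
      · rw [← hp]; exact hadj 0 (by omega)
      · rw [← h2]; exact hadj 1 (by omega)
    obtain ⟨h20, -⟩ := hlong G₀ hG₀
    set T' : V → Finset (SimpleGraph V) := fun z =>
      (regularAbove d H).filter fun G => G.Adj v₀ z ∧ G.Adj z (p₀ 2) ∧
        ¬ (H.Adj v₀ z ∧ H.Adj z (p₀ 2))
    have hsub : T ⊆ Finset.univ.biUnion T' := by
      intro G hG
      obtain ⟨-, z, h1, h2, h3⟩ := hlong G hG
      exact Finset.mem_biUnion.2 ⟨z, Finset.mem_univ z,
        Finset.mem_filter.2 ⟨(hpath G hG).1, h1, h2, h3⟩⟩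
    have hT' : ∀ z, ((T' z).card : ℝ≥0∞) ≤ (if z ∈ S then q else 0) * N + q ^ 2 * N := by
      intro z
      rcases (T' z).eq_empty_or_nonempty with h0 | ⟨G₁, hG₁⟩
      · simp [h0]
      obtain ⟨-, a1, a2, a3⟩ := Finset.mem_filter.1 hG₁
      by_cases hz : z ∈ S
      · rw [if_pos hz]
        refine le_trans ?_ le_self_add
        by_cases h1 : H.Adj v₀ z
        · refine le_trans ?_ (hq H S hS (by omega) z (p₀ 2) a2.ne fun h => a3 ⟨h1, h⟩)
          rw [← filter_regularAbove a2.ne]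
          exact Nat.cast_le.2 (Finset.card_le_card
            (Finset.monotone_filter_right _ fun G _ h => h.2.1))
        · refine le_trans ?_ (hq H S hS (by omega) v₀ z a1.ne h1)
          rw [← filter_regularAbove a1.ne]
          exact Nat.cast_le.2 (Finset.card_le_card
            (Finset.monotone_filter_right _ fun G _ h => h.1))
      · refine le_trans ?_ le_add_self
        have h1 : ¬ H.Adj v₀ z := fun h => hz (hS _ _ h.symm)
        have h2 : ¬ (H ⊔ SimpleGraph.edge v₀ z).Adj z (p₀ 2) := by
          rintro (h | h)
          · exact hz (hS _ _ h)
          · rw [SimpleGraph.edge_adj] at h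
            rcases h.1 with h | h
            · exact a1.ne h.1.symm
            · exact h20 h.2
        have hle : (T' z).card
            ≤ (regularAbove d (H ⊔ SimpleGraph.edge v₀ z ⊔ SimpleGraph.edge z (p₀ 2))).card := by
          rw [← filter_regularAbove a2.ne, ← filter_regularAbove a1.ne, Finset.filter_filter]
          exact Finset.card_le_card (Finset.monotone_filter_right _ fun G _ h => ⟨h.1, h.2.1⟩)
        calc ((T' z).card : ℝ≥0∞) ≤ _ := Nat.cast_le.2 hle
          _ ≤ q * (regularAbove d (H ⊔ SimpleGraph.edge v₀ z)).card := by
            refine hq _ (insert v₀ (insert z S)) (adj_sup_edge_mem hS v₀ z) ?_ _ _ a2.ne h2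
            rw [Finset.insert_eq_of_mem (Finset.mem_insert_of_mem hv₀)]
            have := Finset.card_insert_le z S
            omega
          _ ≤ q * (q * N) := by
            gcongr
            exact hq H S hS (by omega) v₀ z a1.ne h1
          _ = q ^ 2 * N := by ring
    calc (T.card : ℝ≥0∞) ≤ ∑ z, ((T' z).card : ℝ≥0∞) := by
          exact_mod_cast (Finset.card_le_card hsub).trans Finset.card_biUnion_le
      _ ≤ ∑ z, ((if z ∈ S then q else 0) * N + q ^ 2 * N) := by
          gcongr with z
          exact hT' z
      _ = (S.card * q + Fintype.card V * q ^ 2) * N := by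
          rw [Finset.sum_add_distrib, ← Finset.sum_mul]
          simp
          ring
      _ ≤ _ := by
          gcongr
          exact le_add_self

/-- The state of the exploration while the first query is answered, with `r` probes left: the
nonbacktracking walks from `v₀` along revealed edges have at most `m - r` steps. -/
def FirstPhase (v₀ : V) (m r : ℕ) (H : SimpleGraph V) : Prop :=
  ∃ S : Finset V, v₀ ∈ S ∧ S.card + 2 * r ≤ 2 * m + 1 ∧ (∀ a b, H.Adj a b → a ∈ S) ∧
    ∀ l, NonBacktracking H l → l.getLast? = some v₀ → l.length + r ≤ m + 1

/-- The state of the exploration after the answer `x` to the first query, with `r` probes left: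
the nonbacktracking walks from `v₀` to `x` along revealed edges have at most `m` steps. -/
def SecondPhase (v₀ x : V) (m N r : ℕ) (H : SimpleGraph V) : Prop :=
  ∃ S : Finset V, v₀ ∈ S ∧ x ∈ S ∧ S.card + 2 * r ≤ N ∧ (∀ a b, H.Adj a b → a ∈ S) ∧
    ∀ l, NonBacktracking H l → l.head? = some x → l.getLast? = some v₀ → l.length ≤ m + 1

omit [Fintype V] in
theorem card_insert_insert_le (S : Finset V) (v w : V) :
    (insert v (insert w S)).card ≤ S.card + 2 :=
  (Finset.card_insert_le _ _).trans (Nat.succ_le_succ (Finset.card_insert_le _ _))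

omit [Fintype V] in
theorem FirstPhase.mono {v₀ : V} {m r : ℕ} {H : SimpleGraph V} (h : FirstPhase v₀ m (r + 1) H) :
    FirstPhase v₀ m r H := by
  obtain ⟨S, h1, h2, h3, h4⟩ := h
  exact ⟨S, h1, by omega, h3, fun l hl hl' => by have := h4 l hl hl'; omega⟩

omit [Fintype V] in
theorem SecondPhase.mono {v₀ x : V} {m N r : ℕ} {H : SimpleGraph V}
    (h : SecondPhase v₀ x m N (r + 1) H) : SecondPhase v₀ x m N r H := by
  obtain ⟨S, h1, h2, h3, h4⟩ := h
  exact ⟨S, h1, h2, by omega, h4⟩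

omit [Fintype V] in
-- Since `w` becomes pendant and differs from the end `v₀`, a nonbacktracking walk meets it at most
-- at its head. Dropping the head leaves a walk in `H`, so lengths grow by at most one, paid for by
-- the probe. The probed vertex `v` may itself be new, hence two vertices per probe.
theorem FirstPhase.extend {v₀ : V} {m r : ℕ} {H : SimpleGraph V} (v : V)
    (h : FirstPhase v₀ m (r + 1) H) : ∃ S : Finset V, S.card ≤ 2 * m + 1 ∧ ∀ w, w ∉ S → v ≠ w →
      ¬ H.Adj v w → FirstPhase v₀ m r (H ⊔ SimpleGraph.edge v w) := by
  obtain ⟨S, h1, h2, h3, h4⟩ := h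
  refine ⟨S, by omega, fun w hw hvw _ => ⟨insert v (insert w S), by simp [h1], ?_,
    adj_sup_edge_mem h3 v w, ?_⟩⟩
  · have := card_insert_insert_le S v w
    omega
  · intro l hl hlast
    have hwH : ∀ a, ¬ H.Adj a w := fun a ha => hw (h3 _ _ ha.symm)
    have hlw : l.getLast? ≠ some w := by
      rw [hlast]; rintro h; exact hw (Option.some.inj h ▸ h1)
    match l with
    | [] => simp at hlast
    | [a] =>
      have := h4 [a] trivial hlast
      simp at this ⊢
      omega
    | a :: b :: t =>
      by_cases ha : a = w
      · have hb : b ≠ w := fun hb => hl.1.ne (ha.trans hb.symm)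
        have hlast' : (b :: t).getLast? = some v₀ := by simpa using hlast
        have := h4 _ (hl.tail.of_pendant hwH hb (by simpa using hlw)) hlast'
        simp at this ⊢
        omega
      · have := h4 _ (hl.of_pendant hwH ha hlw) hlast
        omega

omit [Fintype V] in
-- Both ends `v₀` and `x` lie in `S`, so the pendant vertex `w` is neither an end nor an interior
-- vertex: no nonbacktracking walk between them is new.
theorem SecondPhase.extend {v₀ x : V} {m N r : ℕ} {H : SimpleGraph V} (v : V)
    (h : SecondPhase v₀ x m N (r + 1) H) : ∃ S : Finset V, S.card ≤ N ∧ ∀ w, w ∉ S → v ≠ w →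
      ¬ H.Adj v w → SecondPhase v₀ x m N r (H ⊔ SimpleGraph.edge v w) := by
  obtain ⟨S, h1, h1', h2, h3, h4⟩ := h
  refine ⟨S, by omega, fun w hw hvw _ => ⟨insert v (insert w S), by simp [h1], by simp [h1'], ?_,
    adj_sup_edge_mem h3 v w, ?_⟩⟩
  · have := card_insert_insert_le S v w
    omega
  · intro l hl hhead hlast
    have hwH : ∀ a, ¬ H.Adj a w := fun a ha => hw (h3 _ _ ha.symm)
    have hlw : l.getLast? ≠ some w := by
      rw [hlast]; rintro h; exact hw (Option.some.inj h ▸ h1)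
    match l with
    | [] => simp at hlast
    | a :: t =>
      have ha : a = x := by simpa using hhead
      refine h4 _ (hl.of_pendant hwH ?_ hlw) hhead hlast
      rintro rfl
      exact hw (ha ▸ h1')

omit [Fintype V] in
theorem firstPhase_bot (v₀ : V) (m : ℕ) : FirstPhase v₀ m m ⊥ := by
  refine ⟨{v₀}, by simp, by simp; omega, fun a b h => h.elim, fun l hl hlast => ?_⟩
  match l with
  | [] => simp at hlast
  | [a] => simp; omega
  | a :: b :: t => exact hl.1.elim

omit [Fintype V] in
theorem FirstPhase.secondPhase {v₀ : V} {m : ℕ} {H : SimpleGraph V} (h : FirstPhase v₀ m 0 H)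
    (x : V) (r : ℕ) : SecondPhase v₀ x m (2 * m + 2 + 2 * r) r H := by
  obtain ⟨S, h1, h2, h3, h4⟩ := h
  refine ⟨insert x S, by simp [h1], by simp, ?_, fun a b h => by simp [h3 a b h],
    fun l hl _ hlast => h4 l hl hlast⟩
  have := Finset.card_insert_le x S
  omega

/-- An algorithm that makes at most `m` probes for each query rarely passes the test. -/
theorem sum_expect_responses_le [Nonempty V] {d : ℕ} (hd : 0 < d) {q : ℝ≥0∞}
    (hq : ∀ (H : SimpleGraph V) (S : Finset V), (∀ a b, H.Adj a b → a ∈ S) →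
      2 * (S.card + 2 * d + 4) ≤ Fintype.card V → ∀ v w, v ≠ w → ¬ H.Adj v w →
      ((regularAbove d (H ⊔ SimpleGraph.edge v w)).card : ℝ≥0∞) ≤ q * (regularAbove d H).card)
    {v₀ : V} {e m s N : ℕ} (he : 3 ≤ e) (hs : s = 1 ∨ s = 2)
    (hN : N = 2 * m + 2 + 2 * ((List.Ico s e).length * m))
    (hcard : 2 * (N + 1 + 2 * d + 4) ≤ Fintype.card V)
    (A : QueryAlgorithm V)
    (hA : ∀ G ∈ regularAbove d (⊥ : SimpleGraph V),
      ∀ out ∈ (A.transcript G (e :: List.Ico s e)).support, ∀ r ∈ out, r.2 ≤ m) :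
    ∑ G ∈ regularAbove d (⊥ : SimpleGraph V), (A.responses G (e :: List.Ico s e)).expect
        (fun out => if IsLongWalk G v₀ e m (e :: List.Ico s e) out then (1 : ℝ≥0∞) else 0)
      ≤ (q + N * q + Fintype.card V * q ^ 2 + ((List.Ico s e).length * m : ℕ) * (N * q)
          + m * (N * q)) * (regularAbove d (⊥ : SimpleGraph V)).card := by
  simp only [QueryAlgorithm.responses, QueryAlgorithm.transcript, PMF.expect_map, PMF.expect_bind]
  rw [PMF.sum_expect]
  refine PMF.expect_le_of_support _ fun x₀ hx₀ => ?_
  simp only [QueryAlgorithm.runFrom, PMF.expect_bind, PMF.expect_map, List.map_cons]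
  set Q := List.Ico s e
  have hsup : ∀ G r rest, r ∈ ((A.answer x₀ e).run G).support →
      rest ∈ (A.runFrom G r.1.2 Q).support →
      (r.1.1, r.2) :: rest ∈ (A.transcript G (e :: Q)).support := fun G r rest hr hrest => by
    rw [QueryAlgorithm.transcript, PMF.mem_support_bind_iff]
    refine ⟨x₀, hx₀, ?_⟩
    rw [QueryAlgorithm.runFrom, PMF.mem_support_bind_iff]
    exact ⟨r, hr, (PMF.mem_support_map_iff _ _ _).2 ⟨rest, hrest, rfl⟩⟩
  -- Here `ε` is the failure probability once `x` is fixed: the bound for a fixed list of answers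
  -- plus the collisions during the later queries.
  have main := sum_expect_run_le hd (I := FirstPhase v₀ m) (σ := N) (q := q)
    (ε := q + N * q + Fintype.card V * q ^ 2 + (Q.length * m : ℕ) * (N * q))
    (fun G a => (A.runFrom G a.2 Q).expect fun out =>
      if IsLongWalk G v₀ e m (e :: Q) (a.1 :: out.map Prod.fst) then (1 : ℝ≥0∞) else 0)
    ?_ (fun _ _ h => h.mono) ?_ ?_ (A.answer x₀ e) m ⊥ (firstPhase_bot v₀ m) ?_ ?_
  · exact main
  · exact fun G a => PMF.expect_le_of_support _ fun _ _ => by split_ifs <;> simp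
  · intro b H v h
    obtain ⟨S, hS, h'⟩ := h.extend v
    exact ⟨S, by omega, h'⟩
  · rintro b H ⟨S, h1, h2, h3, h4⟩
    exact hq H S h3 (by omega)
  · intro G hG r hr
    obtain ⟨rest, hrest⟩ := (A.runFrom G r.1.2 Q).support_nonempty
    exact hA G hG _ (hsup G r rest hr hrest) (r.1.1, r.2) (by simp)
  · rintro H ⟨x, y⟩ - hI hreach
    refine sum_expect_runFrom_le hd A (I := SecondPhase v₀ x m N) (σ := N) (q := q)
      (ε := q + N * q + Fintype.card V * q ^ 2)
      (fun G l => if IsLongWalk G v₀ e m (e :: Q) (x :: l) then (1 : ℝ≥0∞) else 0)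
      (fun G l => by split_ifs <;> simp) (fun _ _ h => h.mono) (fun _ _ v h => h.extend v)
      ?_ ?_ Q y H ?_ ?_
    · rintro b H ⟨S, h1, h1', h2, h3, h4⟩
      exact hq H S h3 (by omega)
    · rintro H l ⟨S, h1, h1', h2, h3, h4⟩
      refine (sum_isLongWalk_le hq h3 (by omega) h1 he hs h4 l).trans ?_
      have : S.card ≤ N := by omega
      gcongr
    · rw [hN]
      exact hI.secondPhase x _
    · intro G hG out hout r hr
      obtain ⟨c, hc⟩ := hreach G hG
      exact hA G (regularAbove_anti bot_le hG) _ (hsup G _ out hc hout) r (by simp [hr])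

end LowerBound

/-! ### Choice of constants and conclusion -/

theorem foldr_max_queryTimes (e s : ℕ) : (e :: List.Ico s e).foldr max 0 = e := by
  have h : ∀ l : List ℕ, (∀ t ∈ l, t ≤ e) → l.foldr max 0 ≤ e := fun l => by
    induction l with
    | nil => simp
    | cons a l ih =>
      intro h
      exact max_le (h a (by simp)) (ih fun t ht => h t (by simp [ht]))
  exact max_eq_left (h _ fun t ht => (List.Ico.mem.1 ht).2.le)

/-- The failure probability of the true walk is small once `e` is much larger than `m`. -/
theorem walk_error_le {e m : ℕ} (h : 10 * m + 150 ≤ e) :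
    ((3 : ℝ) / 2) ^ m * (17 / 18) ^ e ≤ 0.001 := by
  calc ((3 : ℝ) / 2) ^ m * (17 / 18) ^ e
      ≤ (3 / 2) ^ m * (17 / 18) ^ (10 * m + 150) := by
        gcongr ?_ * ?_
        exact pow_le_pow_of_le_one (by norm_num) (by norm_num) h
    _ = ((3 / 2) * (17 / 18) ^ 10) ^ m * (17 / 18) ^ 150 := by
        rw [pow_add, pow_mul, mul_pow, mul_assoc]
    _ ≤ 1 * (17 / 18) ^ 150 := by
        gcongr
        exact pow_le_one₀ (by norm_num) (by norm_num)
    _ ≤ 0.001 := by norm_num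

/-- The total failure probability of the exploration bound, with `M` probes in total. -/
theorem exploration_error_le {n d M : ℝ} (hd : 3 ≤ d) (hn : 100000 * d ^ 2 ≤ n)
    (hM : (100 * d * M) ^ 2 ≤ n) :
    2 * d / n + (2 * M + 2) * (2 * d / n) + n * (2 * d / n) ^ 2
      + M * ((2 * M + 2) * (2 * d / n)) ≤ 0.002 := by
  have hn0 : 0 < n := by nlinarith
  have h1 : 2 * d / n + (2 * M + 2) * (2 * d / n) + n * (2 * d / n) ^ 2
      + M * ((2 * M + 2) * (2 * d / n))
      = (2 * d + 4 * d ^ 2 + 4 * d * (M + 1) ^ 2) / n := by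
    field_simp
    ring
  rw [h1, div_le_iff₀ hn0]
  have h2 : (M + 1) ^ 2 ≤ 2 * M ^ 2 + 2 := by nlinarith [sq_nonneg (M - 1)]
  have h3 : 4 * d * (M + 1) ^ 2 ≤ 8 * d * M ^ 2 + 8 * d := by nlinarith
  have h4 : 8 * d * M ^ 2 ≤ 8 * d ^ 2 * M ^ 2 := by
    gcongr
    nlinarith
  nlinarith

theorem theorem4p15 (d : ℕ) (hd : 3 ≤ d) :
    ∃ k : ℝ, 0 < k ∧ ∃ n₀ : ℕ, ∀ (n : ℕ) [NeZero n], n₀ ≤ n → Even (n * d) →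
      ∀ s : ℕ, s = 1 ∨ s = 2 → ∀ v₀ : Fin n,
        ∃ F : SimpleGraph (Fin n) → List (Fin n) → Bool,
          ∀ A : QueryAlgorithm (Fin n),
            (∀ G ∈ regularGraphs n d,
              A.FewerProbesThan G (queryTimes n s) ((n : ℝ) ^ (1 / 4 : ℝ) / k)) →
            0.99 ≤ expectRegular n d fun G =>
              |acceptProb (F G) (walkPositions G v₀ (queryTimes n s))
                - acceptProb (F G) (A.responses G (queryTimes n s))| := by
  classical
  have hd3 : (3 : ℝ) ≤ d := by exact_mod_cast hd
  have hd0 : 0 < d := by omega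
  -- With `k = 100 d`, the total `M ≤ e * m` satisfies `(100 d M) ^ 2 ≤ n`. The threshold gives `n ^
  -- (1/4) ≥ 200` and makes the terms of order `d ^ 2 / n` negligible.
  refine ⟨100 * d, by positivity, 200 ^ 4 * d ^ 2, fun n _ hn heven s hs v₀ => ?_⟩
  have hnR : (200 : ℝ) ^ 4 * (d : ℝ) ^ 2 ≤ n := by exact_mod_cast hn
  have hn0 : (0 : ℝ) < n := by nlinarith
  set y : ℝ := (n : ℝ) ^ (1 / 4 : ℝ) with hy
  have hy0 : 0 ≤ y := by positivity
  have hy4 : y ^ 4 = n := by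
    rw [hy, ← Real.rpow_natCast, ← Real.rpow_mul hn0.le]; norm_num
  have hy200 : 200 ≤ y := by
    by_contra! h
    have := pow_lt_pow_left₀ h hy0 (n := 4) (by norm_num)
    nlinarith
  obtain ⟨e, he⟩ : ∃ e, e = ⌊y⌋₊ := ⟨_, rfl⟩
  obtain ⟨m, hm⟩ : ∃ m, m = ⌊y / (100 * d)⌋₊ := ⟨_, rfl⟩
  have hey : (e : ℝ) ≤ y := he ▸ Nat.floor_le hy0
  have hye : y < e + 1 := he ▸ Nat.lt_floor_add_one y
  have hmy : 100 * d * (m : ℝ) ≤ y := by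
    have : (m : ℝ) ≤ y / (100 * d) := hm ▸ Nat.floor_le (by positivity)
    rw [le_div_iff₀ (by positivity)] at this
    linarith
  have he200 : 200 ≤ e := he ▸ Nat.le_floor (by exact_mod_cast hy200)
  have hem : 300 * m ≤ e + 1 := by
    have : (300 : ℝ) * m < e + 1 := by
      have := mul_le_mul_of_nonneg_right hd3 (Nat.cast_nonneg (α := ℝ) m)
      linarith
    exact_mod_cast this.le
  have hQ : queryTimes n s = e :: List.Ico s e := by rw [he]; rfl
  rw [hQ]
  obtain ⟨M, hM⟩ : ∃ M, M = (List.Ico s e).length * m + m := ⟨_, rfl⟩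
  have hMe : M ≤ e * m := by
    rw [hM, List.Ico.length, ← Nat.succ_mul]
    exact Nat.mul_le_mul_right m (by omega)
  have hMy : 100 * d * (M : ℝ) ≤ y ^ 2 := by
    have h1 : (M : ℝ) ≤ e * m := by exact_mod_cast hMe
    calc 100 * d * (M : ℝ) ≤ 100 * d * (e * m) := by gcongr
      _ = e * (100 * d * m) := by ring
      _ ≤ y * y := by gcongr
      _ = y ^ 2 := by ring
  have hM2 : (100 * d * (M : ℝ)) ^ 2 ≤ (n : ℝ) := by
    calc (100 * d * (M : ℝ)) ^ 2 ≤ (y ^ 2) ^ 2 := by gcongr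
      _ = (n : ℝ) := by rw [← hy4]; ring
  have hcard : 2 * ((2 * M + 2) + 1 + 2 * d + 4) ≤ n := by
    have h1 : (300 : ℝ) * M ≤ n := by
      have h2 := mul_le_mul_of_nonneg_right hd3 (Nat.cast_nonneg (α := ℝ) M)
      nlinarith [sq_nonneg (y ^ 2 - 1)]
    have h2 : 300 * M ≤ n := by exact_mod_cast h1
    nlinarith
  have hdn : d < n := by omega
  obtain ⟨q, hq⟩ : ∃ q : ℝ, q = 2 * d / n := ⟨_, rfl⟩
  have hq0 : 0 ≤ q := by rw [hq]; positivity
  have hswitch : ∀ (H : SimpleGraph (Fin n)) (S : Finset (Fin n)), (∀ a b, H.Adj a b → a ∈ S) →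
      2 * (S.card + 2 * d + 4) ≤ Fintype.card (Fin n) → ∀ v w, v ≠ w → ¬ H.Adj v w →
      ((regularAbove d (H ⊔ SimpleGraph.edge v w)).card : ℝ≥0∞)
        ≤ ENNReal.ofReal q * (regularAbove d H).card := by
    intro H S hS hS' v w hvw hadj
    have h := card_regularAbove_edge_le hd0 hS hS' hvw hadj
    rw [Fintype.card_fin] at h
    have h' : (n : ℝ) * (regularAbove d (H ⊔ SimpleGraph.edge v w)).card
        ≤ 2 * d * (regularAbove d H).card := by exact_mod_cast h
    rw [← ENNReal.ofReal_natCast, ← ENNReal.ofReal_natCast, ← ENNReal.ofReal_mul hq0]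
    refine ENNReal.ofReal_le_ofReal ?_
    rw [hq, div_mul_eq_mul_div, le_div_iff₀ hn0]
    linarith
  refine ⟨fun G out => decide (IsLongWalk G v₀ e m (e :: List.Ico s e) out), fun A hA => ?_⟩
  have hprobes : ∀ G ∈ regularAbove d (⊥ : SimpleGraph (Fin n)),
      ∀ out ∈ (A.transcript G (e :: List.Ico s e)).support, ∀ r ∈ out, r.2 ≤ m := by
    intro G hG out hout r hr
    rw [← regularGraphs_eq] at hG
    rw [hm]
    exact Nat.le_floor (hA G hG out hout r hr).le
  have hresp := sum_expect_responses_le hd0 hswitch (v₀ := v₀) (N := 2 * M + 2) (by omega) hs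
    (by rw [hM]; ring) (by rw [Fintype.card_fin]; exact hcard) A hprobes
  rw [← regularGraphs_eq, Fintype.card_fin] at hresp
  set R := regularGraphs n d with hR
  have hRpos : (0 : ℝ) < R.card := by
    exact_mod_cast Finset.card_pos.2 (nonempty_regularGraphs hdn heven)
  have herr : ENNReal.ofReal q + (2 * M + 2 : ℕ) * ENNReal.ofReal q + n * ENNReal.ofReal q ^ 2
      + ((List.Ico s e).length * m : ℕ) * ((2 * M + 2 : ℕ) * ENNReal.ofReal q)
      + m * ((2 * M + 2 : ℕ) * ENNReal.ofReal q) ≤ ENNReal.ofReal 0.002 := by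
    have h := exploration_error_le hd3 (by nlinarith) hM2
    rw [← hq] at h
    refine le_trans (le_of_eq ?_) (ENNReal.ofReal_le_ofReal h)
    rw [add_assoc _ (_ * _) (_ * _), ← add_mul, ← Nat.cast_add, ← hM,
      ENNReal.ofReal_add (by positivity) (by positivity),
      ENNReal.ofReal_add (by positivity) (by positivity),
      ENNReal.ofReal_add (by positivity) (by positivity),
      ENNReal.ofReal_mul (by positivity), ENNReal.ofReal_mul (by positivity),
      ENNReal.ofReal_mul (by positivity), ENNReal.ofReal_mul (by positivity),
      ENNReal.ofReal_pow hq0, ENNReal.ofReal_natCast, ENNReal.ofReal_natCast]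
    have : ENNReal.ofReal (2 * (M : ℝ) + 2) = ((2 * M + 2 : ℕ) : ℝ≥0∞) := by
      rw [← ENNReal.ofReal_natCast]; push_cast; rfl
    rw [this]
  have hresp' : ∑ G ∈ R, acceptProb
      (fun out => decide (IsLongWalk G v₀ e m (e :: List.Ico s e) out))
      (A.responses G (e :: List.Ico s e)) ≤ 0.002 * R.card := by
    simp only [acceptProb_eq, decide_eq_true_eq]
    rw [← ENNReal.toReal_sum]
    · refine ENNReal.toReal_le_of_le_ofReal (by positivity) ?_
      rw [ENNReal.ofReal_mul (by norm_num), ENNReal.ofReal_natCast]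
      refine hresp.trans ?_
      gcongr
    · intro G _
      exact ((PMF.expect_le_of_support _ (c := 1) fun _ _ => by split_ifs <;> simp).trans_lt
        ENNReal.one_lt_top).ne
  have hwalk : ∀ G ∈ R, 0.999 ≤ acceptProb
      (fun out => decide (IsLongWalk G v₀ e m (e :: List.Ico s e) out))
      (walkPositions G v₀ (e :: List.Ico s e)) := by
    intro G hG
    rw [hR, regularGraphs_eq, mem_regularAbove] at hG
    have h := acceptProb_walkPositions_ge hd hG.1 v₀ m (e :: List.Ico s e)
    rw [foldr_max_queryTimes] at h
    have h' := walk_error_le (e := e) (m := m) (by omega)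
    norm_num at h h' ⊢
    linarith
  rw [expectRegular, le_div_iff₀ hRpos]
  -- The true walk is accepted with probability at least `0.999` on every graph, the algorithm with
  -- at most `0.002` on average.
  calc 0.99 * (R.card : ℝ) ≤ 0.999 * R.card - 0.002 * R.card := by nlinarith
    _ ≤ ∑ G ∈ R, (0.999 - acceptProb
      (fun out => decide (IsLongWalk G v₀ e m (e :: List.Ico s e) out))
      (A.responses G (e :: List.Ico s e))) := by
        rw [Finset.sum_sub_distrib, Finset.sum_const, nsmul_eq_mul, mul_comm (R.card : ℝ)]
        linarith
    _ ≤ _ := by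
        refine Finset.sum_le_sum fun G hG => ?_
        exact (sub_le_sub_right (hwalk G hG) _).trans (le_abs_self _)
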